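/- Let $(X,d,\mu)$ be a metric space with a $\sigma$-finite Borel regular measure such that $0<\mu(B)<\infty$ for every ball $B$. Let $\Omega\subset X$ be a bounded domain (non-empty, open, connected) which is a length space, i.e. for every $L>1$ any two distinct points $x,y\in\Omega$ are joined by a curve in $\Omega$ of length at most $L\,d(x,y)$. Assume that $\mu|_\Omega$ is doubling: there is $c\ge 1$ with $0<\mu(B(x,2r)\cap\Omega)\le c\,\mu(B(x,r)\cap\Omega)<\infty$ for all $x\in\overline\Omega$, $r>0$. Let $s$ be an exponent for which there is $C_s>0$ with $$\frac{\mu(B(x,r)\cap\Omega)}{\mu(B(y,R)\cap\Omega)}\ge C_s\Bigl(\frac rR\Bigr)^s\qquad\text{for all }0<r\le R,\ y\in\overline\Omega,\ x\in B(y,R)\cap\overline\Omega .$$ Let $\mathcal H$ be a Borel regular measure on $\partial\Omega$ and let $\theta>0$ and $c_\theta>0$ be such that $$\mathcal H(B(x,r)\cap\partial\Omega)\le c_\theta\,\frac{\mu(B(x,r)\cap\Omega)}{r^\theta}\qquad\text{for all }x\in\partial\Omega,\ 0<r<2\operatorname{diam}\Omega .$$ For $0<q<\infty$, a measurable $g\ge0$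 on $\Omega$ is called a $q$-PI gradient of $u$ if there is $\lambda\ge1$ such that $$\frac{1}{\mu(B(x,r)\cap\Omega)}\int_{B(x,r)\cap\Omega}|u-u_{B(x,r)\cap\Omega}|\,d\mu\le r\,\Bigl(\frac1{\mu(B(x,\lambda r)\cap\Omega)}\int_{B(x,\lambda r)\cap\Omega}g^q\,d\mu\Bigr)^{1/q}\qquad\text{for all }x\in\Omega,\ r>0,$$ where $u_E=\mu(E)^{-1}\int_E u\,d\mu$; and $P^{1,p}_q(\Omega)$ is the set of (real-valued) $u\in L^p(\Omega)$ that have a $q$-PI gradient in $L^p(\Omega)$. The trace of $u$ is $Tu(z)=\lim_{r\to0^+}u_{B(z,r)\cap\Omega}$, $z\in\partial\Omega$, wherever this limit exists. Let $p\ge1$, $\theta<p<s$, $p^*=\frac{p(s-\theta)}{s-p}$, $\tilde p\in(p,p^*)$ and $0<q<p$. Then there is a constant $C>0$ such that for every $u\in P^{1,p}_q(\Omega)$ and every $q$-PI gradient $g\in L^p(\Omega)$ of $u$ the following holds. The trace $Tu$ exists $\mathcal H$-a.e. on $\partial\Omega$, belongs to $L^p(\partial\Omega,\mathcal H)$ and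 satisfies $$\lim_{r\to0^+}\frac1{\mu(B(z,r)\cap\Omega)}\int_{B(z,r)\cap\Omega}|u-Tu(z)|\,d\mu=0\qquad\text{for }\mathcal H\text{-a.e. }z\in\partial\Omega,$$ and for every $z\in\partial\Omega$ and $R>0$, with $B=B(z,R)$, $$\|Tu-u_{B\cap\Omega}\|_{L^{\tilde p}(B\cap\partial\Omega,\mathcal H)}\le C\,R^{\left(\frac1{\tilde p}-\frac1{p^*}\right)(s-\theta)}\,\|g\|_{L^p(B\cap\Omega,\mu)} .$$ -/

import Mathlib

open MeasureTheory Filter Topology Set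

noncomputable section

namespace TraceEst

variable {X : Type*} [MetricSpace X]

/-- A domain: a non-empty connected open set. -/
def IsDomain (Ω : Set X) : Prop := IsOpen Ω ∧ IsConnected Ω

/-- `Ω` is `L`-quasiconvex: any two distinct points of `Ω` are joined by a curve inside `Ω`
of length at most `L` times their distance (the length of a curve is its total variation). -/
def IsQuasiconvex (Ω : Set X) (L : ℝ) : Prop :=
  ∀ x ∈ Ω, ∀ y ∈ Ω, x ≠ y → ∃ γ : Path x y, (∀ t, γ t ∈ Ω) ∧
    eVariationOn γ univ ≤ ENNReal.ofReal (L * dist x y)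

/-- `Ω`, with the metric inherited from `X`, is a length space. -/
def IsLengthSpace (Ω : Set X) : Prop := ∀ L : ℝ, 1 < L → IsQuasiconvex Ω L

variable [MeasurableSpace X]

/-- Every ball of `X` has positive and finite measure. -/
def IsNontrivial (μ : Measure X) : Prop :=
  ∀ (x : X) (r : ℝ), 0 < r → 0 < μ (Metric.ball x r) ∧ μ (Metric.ball x r) < ⊤

/-- The restriction of `μ` to `Ω` is non-trivial and doubling, for all balls centred in the
closure of `Ω`. -/
def IsDoublingOn (μ : Measure X) (Ω : Set X) : Prop :=
  ∃ c : ℝ, 1 ≤ c ∧ ∀ x ∈ closure Ω, ∀ r : ℝ, 0 < r →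
    0 < μ (Metric.ball x (2 * r) ∩ Ω) ∧
    μ (Metric.ball x (2 * r) ∩ Ω) ≤ ENNReal.ofReal c * μ (Metric.ball x r ∩ Ω) ∧
    μ (Metric.ball x r ∩ Ω) < ⊤

/-- The relative lower mass bound with exponent `s`:
`μ(B(x,r) ∩ Ω) / μ(B(y,R) ∩ Ω) ≥ C (r/R)^s`. -/
def HasLowerMassExponent (μ : Measure X) (Ω : Set X) (s : ℝ) : Prop :=
  ∃ C : ℝ, 0 < C ∧ ∀ r R : ℝ, 0 < r → r ≤ R → ∀ y ∈ closure Ω,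
    ∀ x ∈ Metric.ball y R ∩ closure Ω,
      ENNReal.ofReal (C * (r / R) ^ s) * μ (Metric.ball y R ∩ Ω) ≤ μ (Metric.ball x r ∩ Ω)

/-- The measure `H` on the boundary of `Ω` has an upper codimension-`θ` bound:
`H(B(x,r) ∩ ∂Ω) ≤ c μ(B(x,r) ∩ Ω) / r^θ` for `x ∈ ∂Ω` and `0 < r < 2 diam Ω`.
(For a bounded `Ω`, the same bound for all `r > 0` would force `H(∂Ω) = 0`.) -/
def HasUpperCodimBound (μ H : Measure X) (Ω : Set X) (θ : ℝ) : Prop :=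
  ∃ c : ℝ, 0 < c ∧ ∀ x ∈ frontier Ω, ∀ r : ℝ, 0 < r → r < 2 * Metric.diam Ω →
    H (Metric.ball x r ∩ frontier Ω) ≤
      ENNReal.ofReal c * (μ (Metric.ball x r ∩ Ω) / ENNReal.ofReal (r ^ θ))

/-- `g` is a `q`-PI gradient of `u` in the metric measure space `Ω`: it is measurable and
non-negative, and for some `Λ ≥ 1` and all balls `B` of `Ω`,
`⨍_B |u - u_B| ≤ rad(B) (⨍_{ΛB} g^q)^{1/q}`. -/
def IsPIGradient (μ : Measure X) (Ω : Set X) (q : ℝ) (u g : X → ℝ) : Prop :=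
  AEStronglyMeasurable g (μ.restrict Ω) ∧ (∀ᵐ x ∂(μ.restrict Ω), 0 ≤ g x) ∧
  ∃ Λ : ℝ, 1 ≤ Λ ∧ ∀ x ∈ Ω, ∀ r : ℝ, 0 < r →
    (⨍⁻ y in Metric.ball x r ∩ Ω, ‖u y - ⨍ w in Metric.ball x r ∩ Ω, u w ∂μ‖ₑ ∂μ) ≤
      ENNReal.ofReal r * (⨍⁻ y in Metric.ball x (Λ * r) ∩ Ω, ‖g y‖ₑ ^ q ∂μ) ^ (1 / q)

/-- The space `P^{1,p}_q(Ω)`: functions in `L^p(Ω)` with a `q`-PI gradient in `L^p(Ω)`. -/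
def MemP (μ : Measure X) (Ω : Set X) (p q : ℝ) (u : X → ℝ) : Prop :=
  MemLp u (ENNReal.ofReal p) (μ.restrict Ω) ∧
    ∃ g : X → ℝ, MemLp g (ENNReal.ofReal p) (μ.restrict Ω) ∧ IsPIGradient μ Ω q u g

/-- The trace operator: `Tu(z) = lim_{r → 0+} u_{B(z,r) ∩ Ω}`
(an unspecified real number at the points `z` where the limit does not exist). -/
def trace (μ : Measure X) (Ω : Set X) (u : X → ℝ) (z : X) : ℝ :=
  limUnder (𝓝[>] (0 : ℝ)) (fun r => ⨍ x in Metric.ball z r ∩ Ω, u x ∂μ)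

/-- `f ∈ L^p(∂Ω)` is a trace of `u`: for `H`-almost every `z ∈ ∂Ω`,
`⨍_{B(z,r) ∩ Ω} |u - f(z)| dμ → 0` as `r → 0+`. -/
def IsTrace (μ H : Measure X) (Ω : Set X) (p : ℝ) (u f : X → ℝ) : Prop :=
  MemLp f (ENNReal.ofReal p) (H.restrict (frontier Ω)) ∧
  ∀ᵐ z ∂(H.restrict (frontier Ω)),
    Tendsto (fun r : ℝ => ⨍⁻ x in Metric.ball z r ∩ Ω, ‖u x - f z‖ₑ ∂μ) (𝓝[>] (0 : ℝ)) (𝓝 0)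

end TraceEst

end

noncomputable section

namespace TraceEst

open Metric
open scoped ENNReal

/-! Two features make the estimate delicate: the gradient is integrated over the same ball as the
trace, without dilation, and the constant may not depend on the dilation `Λ`, which comes with `u`
and `g`. Chains of balls along approximate geodesics deal with both.

Write m for μ restricted to Ω, and let x lie in the closure of Ω and in B(z,R). In a length space
one can move from z to x through points y_k, with dist(x,y_k) = (7/8)^k dist(x,z), along an almost
shortest path; with D_k = (7/8)^k R/6 the balls B(y_k, 3D_k) then stay inside B(z,R)
(`exists_seq_along_geodesic`). The Poincaré inequality is used on balls N ≥ 4Λ times smaller than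
those carrying the gradient. Centres less than D_k apart are joined by at most N steps of length
D_k/N, and each step costs a multiple of D_k/N times one common mean of g^p at scale D_k, so N
cancels (`enorm_ballAvg_sub_le_of_poincareAt`). Summation over k bounds the distance from Tu(x) to
the mean over B(z, R/(6N)) by `chainPotential`, the sum of D_k (mean of g^p near x)^(1/p).

The L^t norm of this potential on the boundary is estimated scale by scale
(`lintegral_chainPotential_rpow_le`). Tonelli and the codimension bound control the L^p norm of one
term, the lower mass bound its supremum, and together they give a factor (7/8)^(kκ) with κ = 1 - θ/t
- s(1/p - 1/t). This κ is positive exactly when t < p*, and then the series is geometric. For t = p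
the potential is therefore finite almost everywhere, which makes the means converge and yields the
trace.

It remains to replace B(z, R/(6N)) by B(z,R). Doubling would bring N back; instead the same
potential bound is applied with m in place of the boundary measure, θ = 0 and t = p, where by
Lebesgue's theorem the limit of the means is u itself. -/

/-! ### Approximate geodesics and separability -/

/-- Approximate geodesics: between any two points of the closure of a length space there are
points at a prescribed distance from the first one that almost realise the distance. -/
theorem IsLengthSpace.exists_dist_eq_dist_lt {X : Type*} [MetricSpace X] {Ω : Set X}
    (h : IsLengthSpace Ω) {x y : X} (hx : x ∈ closure Ω) (hy : y ∈ closure Ω) {t η : ℝ}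
    (ht : 0 < t) (hty : t < dist x y) (hη : 0 < η) :
    ∃ v ∈ Ω, dist x v = t ∧ dist v y < dist x y - t + η := by
  -- Moving both endpoints into Ω and following a curve of length at most d + e loses at most 5e,
  -- hence `η / 6`. The other two bounds keep the new endpoints distinct and on either side of the
  -- sphere of radius t about x.
  set e := min (min (t / 2) ((dist x y - t) / 4)) (η / 6) with he
  have he1 : e ≤ t / 2 := (min_le_left _ _).trans (min_le_left _ _)
  have he2 : e ≤ (dist x y - t) / 4 := (min_le_left _ _).trans (min_le_right _ _)
  have he3 : e ≤ η / 6 := min_le_right _ _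
  have he0 : 0 < e := by
    have : 0 < dist x y - t := by linarith
    positivity
  obtain ⟨x', hx', hxx'⟩ := Metric.mem_closure_iff.1 hx e he0
  obtain ⟨y', hy', hyy'⟩ := Metric.mem_closure_iff.1 hy e he0
  have t1 := dist_triangle x x' y'
  have t2 := dist_triangle x y' y
  have t3 := dist_triangle x' x y
  have t4 := dist_triangle x' y y'
  rw [dist_comm y' y] at t2
  rw [dist_comm x' x] at t3
  set d := dist x' y' with hd
  have hd0 : 0 < d := by linarith
  have hne : x' ≠ y' := dist_pos.1 hd0
  obtain ⟨γ, hγ, hlen⟩ := h (1 + e / d) (by have := div_pos he0 hd0; linarith) x' hx' y' hy' hne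
  rw [← hd] at hlen
  have hL : (1 + e / d) * d = d + e := by field_simp
  rw [hL] at hlen
  have hcont : Continuous fun τ => dist x (γ τ) := continuous_const.dist γ.continuous
  obtain ⟨τ, hτ⟩ : t ∈ range fun τ => dist x (γ τ) := by
    refine mem_range_of_exists_le_of_exists_ge hcont ⟨0, ?_⟩ ⟨1, ?_⟩
    · simp only [γ.source]; linarith
    · simp only [γ.target]; linarith
  simp only at hτ
  refine ⟨γ τ, hγ τ, hτ, ?_⟩
  have hsum : edist x' (γ τ) + edist (γ τ) y' ≤ eVariationOn γ univ := by
    have h1 := eVariationOn.edist_le γ (s := univ ∩ Icc (0 : unitInterval) τ) (x := 0) (y := τ)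
      ⟨trivial, left_mem_Icc.2 unitInterval.nonneg'⟩
      ⟨trivial, right_mem_Icc.2 unitInterval.nonneg'⟩
    have h2 := eVariationOn.edist_le γ (s := univ ∩ Icc τ (1 : unitInterval)) (x := τ) (y := 1)
      ⟨trivial, left_mem_Icc.2 unitInterval.le_one'⟩
      ⟨trivial, right_mem_Icc.2 unitInterval.le_one'⟩
    rw [γ.source] at h1
    rw [γ.target] at h2
    refine (add_le_add h1 h2).trans ?_
    rw [eVariationOn.Icc_add_Icc γ unitInterval.nonneg' unitInterval.le_one' (mem_univ τ)]
    exact eVariationOn.mono γ inter_subset_left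
  have hsum' : dist x' (γ τ) + dist (γ τ) y' ≤ d + e := by
    have := hsum.trans hlen
    rw [edist_dist, edist_dist, ← ENNReal.ofReal_add dist_nonneg dist_nonneg] at this
    exact (ENNReal.ofReal_le_ofReal_iff (by positivity)).1 this
  have t5 := dist_triangle x x' (γ τ)
  have t6 := dist_triangle (γ τ) y' y
  rw [dist_comm y' y] at t6
  linarith

/-- A sequence of points that goes from `z` to `x` geometrically fast, along an approximate
geodesic. -/
theorem exists_seq_along_geodesic {X : Type*} [MetricSpace X] {E : Set X}
    (hE : ∀ x ∈ E, ∀ y ∈ E, ∀ t η : ℝ, 0 < t → t < dist x y → 0 < η →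
      ∃ v ∈ E, dist x v = t ∧ dist v y < dist x y - t + η)
    {x z : X} (hx : x ∈ E) (hz : z ∈ E) {R : ℝ} (hR : dist x z < R) :
    ∃ y : ℕ → X, y 0 = z ∧ ∀ k, y k ∈ E ∧ dist x (y k) = (7 / 8) ^ k * dist x z ∧
      dist (y k) (y (k + 1)) < (7 / 8) ^ k * R / 6 ∧
      dist (y k) z + dist x (y k) < (R + dist x z) / 2 := by
  rcases eq_or_ne x z with rfl | hxz
  · rw [dist_self] at hR
    exact ⟨fun _ => x, rfl, fun k => ⟨hx, by simp, by simp; positivity, by simp; linarith⟩⟩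
  have hm : 0 < dist x z := dist_pos.2 hxz
  let T := {y : X // y ∈ E ∧ 0 < dist x y ∧ dist y z + dist x y < (R + dist x z) / 2}
  have hnext : ∀ y : T, ∃ v : T, dist x v.1 = 7 / 8 * dist x y.1 ∧
      dist y.1 v.1 < dist x y.1 / 6 := by
    rintro ⟨y, hy, he, hs⟩
    -- The first error bound preserves the strict budget for dist y z + dist x y; the second gives a
    -- step shorter than (1/8 + 1/24) dist x y = dist x y / 6.
    obtain ⟨v, hv, hv1, hv2⟩ := hE x hx y hy (7 / 8 * dist x y)
      (min ((R + dist x z) / 2 - (dist y z + dist x y)) (dist x y / 24)) (by linarith)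
      (by linarith) (lt_min (by linarith) (by linarith))
    have m1 := min_le_left ((R + dist x z) / 2 - (dist y z + dist x y)) (dist x y / 24)
    have m2 := min_le_right ((R + dist x z) / 2 - (dist y z + dist x y)) (dist x y / 24)
    have t1 := dist_triangle v y z
    refine ⟨⟨v, hv, by rw [hv1]; linarith, by rw [hv1]; linarith⟩, hv1, ?_⟩
    simp only
    rw [dist_comm]; linarith
  choose next hn1 hn2 using hnext
  let y : ℕ → T := fun k => next^[k] ⟨z, hz, hm, by simp; linarith⟩
  have hsucc : ∀ k, y (k + 1) = next (y k) := fun k => Function.iterate_succ_apply' _ _ _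
  have hdist : ∀ k, dist x (y k).1 = (7 / 8) ^ k * dist x z := by
    intro k
    induction k with
    | zero => simp [y]
    | succ k ih => rw [hsucc, hn1, ih]; ring
  refine ⟨fun k => (y k).1, rfl, fun k => ⟨(y k).2.1, hdist k, ?_, (y k).2.2.2⟩⟩
  simp only
  rw [hsucc]
  refine (hn2 _).trans ?_
  rw [hdist]
  gcongr

/-- A metric space whose balls have positive mass for some σ-finite measure is second
countable. -/
theorem secondCountableTopology_of_ball_pos {X : Type*} [MetricSpace X] [MeasurableSpace X]
    [BorelSpace X] (μ : Measure X) [SFinite μ] (h : ∀ (x : X) (r : ℝ), 0 < r → 0 < μ (ball x r)) :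
    SecondCountableTopology X := by
  refine Metric.secondCountable_of_almost_dense_set fun ε hε => ?_
  -- A maximal ε-separated set is an ε-net, and it is countable because the disjoint balls of radius
  -- ε/2 all have positive measure.
  obtain ⟨S, -, hS⟩ := zorn_subset_nonempty {S : Set X | S.Pairwise fun x y => ε ≤ dist x y}
    (fun c hc hchain hne => ⟨⋃₀ c, (pairwise_sUnion hchain.directedOn).2 fun s hs => hc hs,
      fun s hs => subset_sUnion_of_mem hs⟩) ∅ (pairwise_empty _)
  refine ⟨S, ?_, fun x => ?_⟩
  · have hdisj : Pairwise (Function.onFun Disjoint fun x : S => ball x.1 (ε / 2)) := by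
      intro x y hxy
      refine ball_disjoint_ball ?_
      have := hS.prop x.2 y.2 (fun h => hxy (Subtype.ext h))
      linarith
    have := Measure.countable_meas_pos_of_disjoint_iUnion (μ := μ)
      (fun x : S => measurableSet_ball) hdisj
    have huniv : {i : S | 0 < μ (ball i.1 (ε / 2))} = univ :=
      eq_univ_of_forall fun i => h _ _ (by positivity)
    rw [huniv] at this
    exact countable_univ_iff.1 this
  · by_contra! hcon
    have hins : insert x S ∈ {S : Set X | S.Pairwise fun x y => ε ≤ dist x y} := by
      refine hS.prop.insert fun y hy _ => ⟨(hcon y hy).le, ?_⟩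
      rw [dist_comm]; exact (hcon y hy).le
    have hx : x ∈ S := hS.le_of_ge hins (subset_insert x S) (mem_insert x S)
    have := hcon x hx
    rw [dist_self] at this
    linarith

/-! ### Doubling, mean values and chains of small balls -/

/-- The measure `m` is non-trivial and doubling with constant `c` on all balls centred in `E`. -/
structure IsDoublingAt {X : Type*} [MetricSpace X] [MeasurableSpace X] (m : Measure X) (E : Set X)
    (c : ℝ≥0∞) : Prop where
  ne_top : c ≠ ⊤
  pos : ∀ x ∈ E, ∀ r : ℝ, 0 < r → 0 < m (ball x r)
  lt_top : ∀ x ∈ E, ∀ r : ℝ, 0 < r → m (ball x r) < ⊤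
  two_mul : ∀ x ∈ E, ∀ r : ℝ, 0 < r → m (ball x (2 * r)) ≤ c * m (ball x r)

/-- The mean value of `u` over a ball. -/
def ballAvg {X : Type*} [MetricSpace X] [MeasurableSpace X] (m : Measure X) (u : X → ℝ) (x : X)
    (r : ℝ) : ℝ := ⨍ y in ball x r, u y ∂m

/-- The mean oscillation of `u` over a ball. -/
def ballOsc {X : Type*} [MetricSpace X] [MeasurableSpace X] (m : Measure X) (u : X → ℝ) (x : X)
    (r : ℝ) : ℝ≥0∞ := ⨍⁻ y in ball x r, ‖u y - ballAvg m u x r‖ₑ ∂m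

/-- A Poincaré inequality for `u` in which the balls on the left are `N` times smaller than those
on the right; `w` plays the role of the `p`-th power of a gradient. -/
def PoincareAt {X : Type*} [MetricSpace X] [MeasurableSpace X] (m : Measure X) (E : Set X)
    (p : ℝ) (A : ℝ≥0∞) (N : ℕ) (u : X → ℝ) (w : X → ℝ≥0∞) : Prop :=
  ∀ x ∈ E, ∀ D : ℝ, 0 < D → ballOsc m u x (D / N) ≤
    A * ENNReal.ofReal (D / N) * ((m (ball x D))⁻¹ * ∫⁻ y in ball x D, w y ∂m) ^ (1 / p)

section Average

variable {X : Type*} [MeasurableSpace X] {m : Measure X}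

theorem enorm_setAverage_sub_le {u : X → ℝ} {A : Set X} (hu : IntegrableOn u A m) (h0 : m A ≠ 0)
    (h1 : m A ≠ ⊤) (a : ℝ) : ‖(⨍ y in A, u y ∂m) - a‖ₑ ≤ ⨍⁻ y in A, ‖u y - a‖ₑ ∂m := by
  have : (⨍ y in A, u y ∂m) - a = ⨍ y in A, (u y - a) ∂m := by
    have hc : a = ⨍ _ in A, a ∂m := (setAverage_const h0 h1 a).symm
    conv_lhs => rw [hc]
    rw [average, average, average, ← integral_sub]
    · exact Integrable.to_average hu
    · have : IsFiniteMeasure (m.restrict A) := ⟨by simpa using h1.lt_top⟩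
      exact (integrable_const a).to_average
  rw [this]
  exact enorm_integral_le_lintegral_enorm _

theorem setLAverage_le_mul {A B : Set X} (hAB : A ⊆ B) {K : ℝ≥0∞} (hK : m B ≤ K * m A)
    (hA0 : m A ≠ 0) (hA : m A ≠ ⊤) (hB : m B ≠ ⊤) (f : X → ℝ≥0∞) :
    ⨍⁻ y in A, f y ∂m ≤ K * ⨍⁻ y in B, f y ∂m := by
  have hB0 : m B ≠ 0 := fun h => hA0 (measure_mono_null hAB h)
  rw [setLAverage_eq, ENNReal.div_le_iff hA0 hA]
  calc ∫⁻ y in A, f y ∂m ≤ ∫⁻ y in B, f y ∂m := lintegral_mono_set hAB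
    _ = m B * ⨍⁻ y in B, f y ∂m := (measure_mul_setLAverage f hB).symm
    _ ≤ K * m A * ⨍⁻ y in B, f y ∂m := by gcongr
    _ = _ := by ring

theorem setLAverage_enorm_sub_le {u : X → ℝ} {A : Set X}
    (h0 : m A ≠ 0) (h1 : m A ≠ ⊤) (a b : ℝ) :
    ⨍⁻ y in A, ‖u y - b‖ₑ ∂m ≤ ⨍⁻ y in A, ‖u y - a‖ₑ ∂m + ‖a - b‖ₑ := by
  rw [← setLAverage_const h0 h1 ‖a - b‖ₑ, setLAverage_eq, setLAverage_eq, setLAverage_eq,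
    ← ENNReal.add_div, ← lintegral_add_right _ measurable_const]
  refine ENNReal.div_le_div_right (lintegral_mono fun y => ?_) _
  rw [← sub_add_sub_cancel (u y) a b]
  exact enorm_add_le _ _

end Average

section Doubling

variable {X : Type*} [MetricSpace X] [MeasurableSpace X] {m : Measure X} {E : Set X} {c : ℝ≥0∞}

theorem IsDoublingAt.pow_mul (h : IsDoublingAt m E c) {x : X} (hx : x ∈ E) {r : ℝ} (hr : 0 < r)
    (n : ℕ) : m (ball x (2 ^ n * r)) ≤ c ^ n * m (ball x r) := by
  induction n with
  | zero => simp
  | succ n ih =>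
    have := h.two_mul x hx (2 ^ n * r) (by positivity)
    rw [← mul_assoc, ← pow_succ'] at this
    refine this.trans ?_
    rw [pow_succ', mul_assoc]
    gcongr

theorem IsDoublingAt.ball_le (h : IsDoublingAt m E c) {x y : X} (hx : x ∈ E) {r r' : ℝ}
    (hr : 0 < r) (n : ℕ) (hy : dist y x + r' ≤ 2 ^ n * r) :
    m (ball y r') ≤ c ^ n * m (ball x r) :=
  (measure_mono (ball_subset_ball' (by linarith))).trans (h.pow_mul hx hr n)

theorem IsDoublingAt.inv_ball_le (h : IsDoublingAt m E c) {x y : X} (hx : x ∈ E) (hy : y ∈ E)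
    {r r' : ℝ} (hr : 0 < r) (hr' : 0 < r') (n : ℕ) (hd : dist y x + r' ≤ 2 ^ n * r) :
    (m (ball x r))⁻¹ ≤ c ^ n * (m (ball y r'))⁻¹ := by
  have h1 := h.ball_le hx hr n hd
  rw [← div_eq_mul_inv, ENNReal.le_div_iff_mul_le (.inl (h.pos y hy r' hr').ne')
    (.inl (h.lt_top y hy r' hr').ne), mul_comm, ← div_eq_mul_inv]
  exact ENNReal.div_le_of_le_mul h1

/-- The mean value over a ball `B` differs from any number `a` at most by a multiple of the
mean distance to `a` over a comparable ball that contains `B`. -/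
theorem IsDoublingAt.enorm_ballAvg_sub_le (h : IsDoublingAt m E c) {u : X → ℝ}
    (hu : Integrable u m) {x y : X} (hx : x ∈ E) (hy : y ∈ E) {r r' : ℝ} (hr : 0 < r)
    (hr' : 0 < r') (n : ℕ) (h1 : dist x y + r ≤ r') (h2 : dist y x + r' ≤ 2 ^ n * r) (a : ℝ) :
    ‖ballAvg m u x r - a‖ₑ ≤ c ^ n * ⨍⁻ v in ball y r', ‖u v - a‖ₑ ∂m :=
  (enorm_setAverage_sub_le hu.integrableOn (h.pos x hx r hr).ne' (h.lt_top x hx r hr).ne a).trans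
    (setLAverage_le_mul (ball_subset_ball' (by linarith)) (h.ball_le hx hr n h2)
      (h.pos x hx r hr).ne' (h.lt_top x hx r hr).ne (h.lt_top y hy r' hr').ne _)

/-- Both balls lie in B(x,2r) and have comparable mass, so each mean is close to the mean over
B(x,2r). -/
theorem IsDoublingAt.enorm_ballAvg_sub_ballAvg_le (h : IsDoublingAt m E c) {u : X → ℝ}
    (hu : Integrable u m) {x y : X} (hx : x ∈ E) (hy : y ∈ E) {r : ℝ} (hr : 0 < r)
    (hxy : dist x y ≤ r) :
    ‖ballAvg m u x r - ballAvg m u y r‖ₑ ≤ 2 * c ^ 2 * ballOsc m u x (2 * r) := by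
  have h1 := h.enorm_ballAvg_sub_le hu hx hx hr (r' := 2 * r) (by positivity) 2
    (by rw [dist_self]; linarith) (by rw [dist_self]; linarith) (ballAvg m u x (2 * r))
  have h2 := h.enorm_ballAvg_sub_le hu hy hx hr (r' := 2 * r) (by positivity) 2
    (by rw [dist_comm]; linarith) (by linarith) (ballAvg m u x (2 * r))
  rw [← sub_sub_sub_cancel_right _ _ (ballAvg m u x (2 * r))]
  refine enorm_sub_le.trans ((add_le_add h1 h2).trans (le_of_eq ?_))
  rw [ballOsc]
  ring

/-- Mean values over two small balls whose centres are far apart, compared by a chain of small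
balls. The constant does not depend on how much smaller the balls are. -/
theorem IsDoublingAt.enorm_ballAvg_sub_le_of_poincareAt (h : IsDoublingAt m E c)
    (hE : ∀ x ∈ E, ∀ y ∈ E, ∀ t η : ℝ, 0 < t → t < dist x y → 0 < η →
      ∃ v ∈ E, dist x v = t ∧ dist v y < dist x y - t + η)
    {u : X → ℝ} (hu : Integrable u m) {w : X → ℝ≥0∞} {p : ℝ} (hp : 0 < p) {A : ℝ≥0∞} {N : ℕ}
    (hN : 0 < N) (hPI : PoincareAt m E p A N u w) {x y : X} (hx : x ∈ E) (hy : y ∈ E) {D : ℝ}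
    (hxy : dist x y < D) :
    ‖ballAvg m u x (D / N) - ballAvg m u y (D / N)‖ₑ ≤ 4 * c ^ 2 * A * ENNReal.ofReal D *
      ((m (ball y D))⁻¹ * ∫⁻ v in ball y (3 * D), w v ∂m) ^ (1 / p) := by
  have hD : 0 < D := dist_nonneg.trans_lt hxy
  have hN' : (0 : ℝ) < N := by exact_mod_cast hN
  set r := D / N with hr
  have hr0 : 0 < r := by positivity
  have hNr : N * r = D := by rw [hr]; field_simp
  set S := 2 * c ^ 2 * (A * ENNReal.ofReal (2 * r) *
    ((m (ball y D))⁻¹ * ∫⁻ v in ball y (3 * D), w v ∂m) ^ (1 / p)) with hS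
  have hstep : ∀ a ∈ E, ∀ b ∈ E, dist a y < D → dist a b ≤ r →
      ‖ballAvg m u a r - ballAvg m u b r‖ₑ ≤ S := by
    intro a ha b hb hay hab
    refine (h.enorm_ballAvg_sub_ballAvg_le hu ha hb hr0 hab).trans ?_
    -- At scale 2D every step sees the same mean, since B(y,D) ⊆ B(a,2D) ⊆ B(y,3D); no doubling
    -- factor depending on N arises.
    have := hPI a ha (2 * D) (by positivity)
    rw [mul_div_assoc, ← hr] at this
    rw [hS]
    gcongr
    refine this.trans ?_
    gcongr
    · exact ball_subset_ball' (by rw [dist_comm]; linarith)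
    · exact ball_subset_ball' (by linarith)
  have hchain : ∀ n : ℕ, n ≤ N → ∀ a ∈ E, dist a y < n * r →
      ‖ballAvg m u a r - ballAvg m u y r‖ₑ ≤ n * S := by
    intro n
    induction n with
    | zero => intro _ a _ hay; simp at hay; exact absurd hay (not_lt.2 dist_nonneg)
    | succ n ih =>
      intro hn a ha hay
      have hnD : ((n + 1 : ℕ) : ℝ) * r ≤ D := by
        rw [← hNr]; gcongr
      push_cast at hay hnD ⊢
      rcases le_or_gt (dist a y) r with h1 | h1
      · refine (hstep a ha y hy (by linarith) h1).trans ?_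
        exact le_mul_of_one_le_left zero_le (by simp)
      -- One step of length r towards y; the error is the slack in the strict bound, which leaves
      -- dist v y < n * r.
      · obtain ⟨v, hv, hav, hvy⟩ := hE a ha y hy r ((n + 1) * r - dist a y) hr0 h1 (by linarith)
        have i1 := hstep a ha v hv (by linarith) hav.le
        have i2 := ih (by omega) v hv (by linarith)
        rw [← sub_add_sub_cancel _ (ballAvg m u v r)]
        refine (enorm_add_le _ _).trans ((add_le_add i1 i2).trans ?_)
        rw [add_mul, one_mul, add_comm]
  refine (hchain N le_rfl x hx (by rwa [hNr])).trans ?_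
  have : (N : ℝ≥0∞) * ENNReal.ofReal (2 * r) = 2 * ENNReal.ofReal D := by
    rw [← ENNReal.ofReal_natCast, ← ENNReal.ofReal_mul (by positivity), ← ENNReal.ofReal_ofNat 2,
      ← ENNReal.ofReal_mul (by positivity), ← hNr]
    ring_nf
  rw [hS]
  calc _ = 2 * c ^ 2 * A * (N * ENNReal.ofReal (2 * r)) *
        ((m (ball y D))⁻¹ * ∫⁻ v in ball y (3 * D), w v ∂m) ^ (1 / p) := by ring
    _ ≤ _ := by rw [this]; exact le_of_eq (by ring)

end Doubling

/-! ### The chain potential and pointwise bounds -/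

/-- The radii of a geometric sequence of balls that starts at scale `R`. -/
def geomScale (R : ℝ) (k : ℕ) : ℝ := (7 / 8) ^ k * R / 6

theorem geomScale_pos {R : ℝ} (hR : 0 < R) (k : ℕ) : 0 < geomScale R k := by
  unfold geomScale; positivity

theorem geomScale_succ (R : ℝ) (k : ℕ) : geomScale R (k + 1) = 7 / 8 * geomScale R k := by
  unfold geomScale; ring

theorem tendsto_geomScale (R : ℝ) : Tendsto (geomScale R) atTop (𝓝 0) := by
  have h := (tendsto_pow_atTop_nhds_zero_of_lt_one (r := (7 / 8 : ℝ)) (by norm_num)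
    (by norm_num)).mul_const (R / 6)
  rw [zero_mul] at h
  refine h.congr fun k => ?_
  unfold geomScale; ring

section

variable {X : Type*} [MetricSpace X] [MeasurableSpace X]

/-- The `L^p` mean over a ball and inside a set `F` of a function with `p`-th power `w`. -/
def localMean (m : Measure X) (p : ℝ) (w : X → ℝ≥0∞) (F : Set X) (D : ℝ) (x : X) : ℝ≥0∞ :=
  ((m (ball x D))⁻¹ * ∫⁻ v in ball x (9 * D) ∩ F, w v ∂m) ^ (1 / p)

/-- A discrete Riesz-type potential that controls mean values along chains of balls. -/
def chainPotential (m : Measure X) (p : ℝ) (w : X → ℝ≥0∞) (F : Set X) (R : ℝ) (x : X) : ℝ≥0∞ :=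
  ∑' k, ENNReal.ofReal (geomScale R k) * localMean m p w F (geomScale R k) x

variable {m : Measure X} {E : Set X} {c : ℝ≥0∞}

/-- Recentres a mean from a chain ball to x. Since dist x a + D ≤ 7D ≤ 2^3 D, three doublings
suffice, and 9 = 6 + 3 in `localMean` leaves room for the balls of radius 3D. -/
theorem IsDoublingAt.rpow_mean_le_localMean (h : IsDoublingAt m E c) {p : ℝ} (hp : 0 < p)
    {w : X → ℝ≥0∞} {F : Set X} {x a : X} (hx : x ∈ E) (ha : a ∈ E) {D ρ : ℝ} (hD : 0 < D)
    (h6 : dist x a ≤ 6 * D) (h9 : dist x a + ρ ≤ 9 * D) (hF : ball a ρ ⊆ F) :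
    ((m (ball a D))⁻¹ * ∫⁻ v in ball a ρ, w v ∂m) ^ (1 / p) ≤
      (c ^ 3) ^ (1 / p) * localMean m p w F D x := by
  rw [localMean, ← ENNReal.mul_rpow_of_nonneg _ _ (by positivity), ← mul_assoc]
  gcongr
  · exact h.inv_ball_le ha hx hD hD 3 (by linarith)
  · exact subset_inter (ball_subset_ball' (by rw [dist_comm]; linarith)) hF

theorem IsDoublingAt.tendsto_ballAvg (h : IsDoublingAt m E c) {u : X → ℝ}
    (hu : Integrable u m) {x : X} {f : ℝ}
    (hf : Tendsto (fun r => ⨍⁻ v in ball x r, ‖u v - f‖ₑ ∂m) (𝓝[>] 0) (𝓝 0)) (hx : x ∈ E)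
    {y : ℕ → X} {r r' : ℕ → ℝ} (hy : ∀ k, y k ∈ E) (hr : ∀ k, 0 < r k) (hr' : ∀ k, 0 < r' k)
    (hlim : Tendsto r' atTop (𝓝 0)) (n : ℕ) (h1 : ∀ k, dist (y k) x + r k ≤ r' k)
    (h2 : ∀ k, dist x (y k) + r' k ≤ 2 ^ n * r k) :
    Tendsto (fun k => ballAvg m u (y k) (r k)) atTop (𝓝 f) := by
  rw [tendsto_iff_edist_tendsto_0]
  have h0 : Tendsto (fun k => c ^ n * ⨍⁻ v in ball x (r' k), ‖u v - f‖ₑ ∂m) atTop (𝓝 0) := by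
    have := ENNReal.Tendsto.const_mul (a := c ^ n) (hf.comp (tendsto_nhdsWithin_iff.2
      ⟨hlim, Eventually.of_forall hr'⟩)) (.inr (ENNReal.pow_ne_top h.ne_top))
    simpa using this
  refine tendsto_of_tendsto_of_tendsto_of_le_of_le tendsto_const_nhds h0 (fun _ => zero_le)
    fun k => ?_
  simp only
  rw [edist_eq_enorm_sub]
  exact h.enorm_ballAvg_sub_le hu (hy k) hx (hr k) (hr' k) n (h1 k) (h2 k) f

theorem IsDoublingAt.tendsto_ballAvg_nhdsGT (h : IsDoublingAt m E c) {u : X → ℝ}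
    (hu : Integrable u m) {x : X} (hx : x ∈ E) {f : ℝ}
    (hf : Tendsto (fun r => ⨍⁻ v in ball x r, ‖u v - f‖ₑ ∂m) (𝓝[>] 0) (𝓝 0)) :
    Tendsto (fun r => ballAvg m u x r) (𝓝[>] 0) (𝓝 f) := by
  rw [tendsto_iff_edist_tendsto_0]
  refine tendsto_of_tendsto_of_tendsto_of_le_of_le' tendsto_const_nhds hf
    (Eventually.of_forall fun _ => zero_le) ?_
  filter_upwards [self_mem_nhdsWithin] with r hr
  rw [edist_eq_enorm_sub]
  simpa using h.enorm_ballAvg_sub_le hu hx hx hr hr 0 (by simp) (by simp) f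

/-- At points where the mean values converge, the limit is controlled by a mean value over a fixed
small ball centred at `z` and a potential that only sees the gradient inside `ball z R`. -/
theorem IsDoublingAt.enorm_ballAvg_sub_le_chainPotential (h : IsDoublingAt m E c)
    (hE : ∀ x ∈ E, ∀ y ∈ E, ∀ t η : ℝ, 0 < t → t < dist x y → 0 < η →
      ∃ v ∈ E, dist x v = t ∧ dist v y < dist x y - t + η)
    {u : X → ℝ} (hu : Integrable u m) {w : X → ℝ≥0∞} {p : ℝ} (hp : 0 < p) {A : ℝ≥0∞} {N : ℕ}
    (hN : 0 < N) (hPI : PoincareAt m E p A N u w) {x z : X} (hx : x ∈ E) (hz : z ∈ E) {R : ℝ}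
    (hxz : dist x z < R) {f : ℝ}
    (hf : Tendsto (fun r => ⨍⁻ v in ball x r, ‖u v - f‖ₑ ∂m) (𝓝[>] 0) (𝓝 0)) :
    ‖ballAvg m u z (geomScale R 0 / N) - f‖ₑ ≤
      (4 * c ^ 2 + c) * A * (c ^ 3) ^ (1 / p) * chainPotential m p w (ball z R) R x := by
  have hR : 0 < R := dist_nonneg.trans_lt hxz
  have hN' : (1 : ℝ) ≤ N := by exact_mod_cast hN
  obtain ⟨y, hy0, hy⟩ := exists_seq_along_geodesic hE hx hz hxz
  choose hyE hyx hyy hyz using hy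
  have hD : ∀ k, 0 < geomScale R k := geomScale_pos hR
  have hyx6 : ∀ k, dist x (y k) ≤ 6 * geomScale R k := by
    intro k
    rw [hyx, geomScale, mul_div_cancel₀ _ (by norm_num)]
    gcongr
  -- This keeps the gradient inside B(z,R): progress towards x frees at least as much room as the
  -- radius 3D_k requires.
  have hyz3 : ∀ k, dist (y k) z + 3 * geomScale R k ≤ R := by
    intro k
    have h1 := hyz k
    have h2 : (7 / 8 : ℝ) ^ k ≤ 1 := pow_le_one₀ (by norm_num) (by norm_num)
    have h3 : (0 : ℝ) < (7 / 8) ^ k := by positivity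
    rw [hyx] at h1
    unfold geomScale
    have h4 := dist_nonneg (x := x) (y := z)
    nlinarith [mul_nonneg (sub_nonneg.2 h2) hR.le, mul_nonneg h3.le h4]
  -- The balls sit in B(x, 8D_k), at the price of the doubling factor c^(14N). It depends on N but
  -- only multiplies a quantity tending to 0, so it does not enter the final bound.
  have hlim : Tendsto (fun k => ballAvg m u (y k) (geomScale R k / N)) atTop (𝓝 f) := by
    refine h.tendsto_ballAvg hu hf hx (r' := fun k => 8 * geomScale R k) hyE
      (fun k => div_pos (hD k) (by linarith)) (fun k => by have := hD k; positivity)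
      (by simpa using (tendsto_geomScale R).const_mul 8) (14 * N) (fun k => ?_) fun k => ?_
    · have := div_le_self (hD k).le hN'
      have := hyx6 k
      have := hD k
      rw [dist_comm]; linarith
    · have h1 : ((14 * N : ℕ) : ℝ) ≤ 2 ^ (14 * N) := by exact_mod_cast Nat.lt_two_pow_self.le
      have h2 : (14 * N : ℕ) * (geomScale R k / N) ≤ 2 ^ (14 * N) * (geomScale R k / N) := by
        have := hD k
        gcongr
      have h3 : ((14 * N : ℕ) : ℝ) * (geomScale R k / N) = 14 * geomScale R k := by
        push_cast; field_simp
      have := hyx6 k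
      linarith
  have hstep : ∀ k, edist (ballAvg m u (y k) (geomScale R k / N))
      (ballAvg m u (y (k + 1)) (geomScale R (k + 1) / N)) ≤
      (4 * c ^ 2 + c) * A * (c ^ 3) ^ (1 / p) *
        (ENNReal.ofReal (geomScale R k) * localMean m p w (ball z R) (geomScale R k) x) := by
    intro k
    have hDk := hD k
    have hyyk : dist (y (k + 1)) (y k) < geomScale R k := by rw [dist_comm]; exact hyy k
    have hzk : dist (y (k + 1)) z ≤ dist (y (k + 1)) (y k) + dist (y k) z := dist_triangle _ _ _
    have hx6 := hyx6 k
    have hx6' := hyx6 (k + 1)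
    have hz3 := hyz3 k
    have hDk1 := geomScale_succ R k
    -- From one link to the next, the centre moves first at the old radius (`e1`), then the radius
    -- shrinks at the new centre (`e2`, `e3`).
    have e1 := h.enorm_ballAvg_sub_le_of_poincareAt hE hu hp hN hPI (hyE (k + 1)) (hyE k) hyyk
    have e2 := h.enorm_ballAvg_sub_le hu (hyE (k + 1)) (hyE (k + 1))
      (r := geomScale R (k + 1) / N) (r' := geomScale R k / N)
      (div_pos (hD _) (by linarith)) (div_pos hDk (by linarith)) 1
      (by rw [dist_self, zero_add]; gcongr; linarith)
      (by rw [dist_self, zero_add, pow_one, ← mul_div_assoc]; gcongr; linarith)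
      (ballAvg m u (y (k + 1)) (geomScale R k / N))
    have e3 := hPI (y (k + 1)) (hyE (k + 1)) (geomScale R k) hDk
    have g1 := h.rpow_mean_le_localMean (w := w) (F := ball z R) hp hx (hyE k) hDk
      (ρ := 3 * geomScale R k) hx6 (by linarith) (ball_subset_ball' (by linarith))
    have g2 := h.rpow_mean_le_localMean (w := w) (F := ball z R) hp hx (hyE (k + 1)) hDk
      (ρ := geomScale R k) (by linarith) (by linarith) (ball_subset_ball' (by linarith))
    rw [edist_comm, edist_eq_enorm_sub,
      ← sub_add_sub_cancel _ (ballAvg m u (y (k + 1)) (geomScale R k / N)), add_comm]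
    refine (enorm_add_le _ _).trans ?_
    have e4 : ENNReal.ofReal (geomScale R k / N) ≤ ENNReal.ofReal (geomScale R k) :=
      ENNReal.ofReal_le_ofReal (div_le_self hDk.le hN')
    calc _ ≤ 4 * c ^ 2 * A * ENNReal.ofReal (geomScale R k) *
          ((c ^ 3) ^ (1 / p) * localMean m p w (ball z R) (geomScale R k) x) +
          c ^ 1 * (A * ENNReal.ofReal (geomScale R k) *
            ((c ^ 3) ^ (1 / p) * localMean m p w (ball z R) (geomScale R k) x)) := by
          refine add_le_add (e1.trans (by gcongr)) (e2.trans ?_)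
          gcongr
          exact e3.trans (by gcongr)
      _ = _ := by ring
  have := edist_le_tsum_of_edist_le_of_tendsto₀ _ hstep hlim
  rwa [ENNReal.tsum_mul_left, hy0, edist_eq_enorm_sub] at this

/-- Where the potential is finite, `u` has a limit in the sense of means over shrinking balls. -/
theorem IsDoublingAt.exists_tendsto_of_chainPotential_ne_top (h : IsDoublingAt m E c)
    {u : X → ℝ} (hu : Integrable u m) {w : X → ℝ≥0∞} {p : ℝ} (hp : 0 < p) {A : ℝ≥0∞}
    (hA : A ≠ ⊤) {N : ℕ} (hN : 0 < N) (hPI : PoincareAt m E p A N u w) {x : X} (hx : x ∈ E)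
    {R : ℝ} (hR : 0 < R) (hfin : chainPotential m p w univ R x ≠ ⊤) :
    ∃ f : ℝ, Tendsto (fun r => ⨍⁻ v in ball x r, ‖u v - f‖ₑ ∂m) (𝓝[>] 0) (𝓝 0) := by
  have hN' : (1 : ℝ) ≤ N := by exact_mod_cast hN
  have hD : ∀ k, 0 < geomScale R k := geomScale_pos hR
  have hr : ∀ k, 0 < geomScale R k / N := fun k => div_pos (hD k) (by linarith)
  set a : ℕ → ℝ := fun k => ballAvg m u x (geomScale R k / N) with ha
  have hosc : ∀ k, ballOsc m u x (geomScale R k / N) ≤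
      A * (ENNReal.ofReal (geomScale R k) * localMean m p w univ (geomScale R k) x) := by
    intro k
    have hDk := hD k
    refine (hPI x hx _ hDk).trans ?_
    rw [mul_assoc, localMean]
    gcongr
    · exact div_le_self hDk.le hN'
    · rw [inter_univ]; exact ball_subset_ball (by linarith)
  have hstep : ∀ k, edist (a k) (a (k + 1)) ≤ c * (A *
      (ENNReal.ofReal (geomScale R k) * localMean m p w univ (geomScale R k) x)) := by
    intro k
    have hDk := hD k
    have hDk1 := geomScale_succ R k
    have e2 := h.enorm_ballAvg_sub_le hu hx hx
      (r := geomScale R (k + 1) / N) (r' := geomScale R k / N) (hr _) (hr _) 1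
      (by rw [dist_self, zero_add]; gcongr; linarith)
      (by rw [dist_self, zero_add, pow_one, ← mul_div_assoc]; gcongr; linarith) (a k)
    rw [edist_comm, edist_eq_enorm_sub]
    rw [pow_one] at e2
    refine e2.trans ?_
    gcongr
    exact hosc k
  obtain ⟨f, hf⟩ := cauchySeq_tendsto_of_complete (cauchySeq_of_edist_le_of_tsum_ne_top _ hstep
    (by
      rw [ENNReal.tsum_mul_left, ENNReal.tsum_mul_left]
      exact ENNReal.mul_ne_top h.ne_top (ENNReal.mul_ne_top hA hfin)))
  refine ⟨f, ?_⟩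
  have hosc0 : Tendsto (fun k => ballOsc m u x (geomScale R k / N)) atTop (𝓝 0) := by
    have h0 := ENNReal.Tendsto.const_mul (a := A)
      (ENNReal.tendsto_atTop_zero_of_tsum_ne_top hfin) (.inr hA)
    rw [mul_zero] at h0
    exact tendsto_of_tendsto_of_tendsto_of_le_of_le tendsto_const_nhds h0 (fun _ => zero_le) hosc
  have hb : Tendsto (fun k => c * (ballOsc m u x (geomScale R k / N) + ‖a k - f‖ₑ)) atTop
      (𝓝 0) := by
    have h0 := ENNReal.Tendsto.const_mul (a := c)
      (hosc0.add (tendsto_iff_edist_tendsto_0.1 hf)) (.inr h.ne_top)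
    simpa only [edist_eq_enorm_sub, add_zero, mul_zero] using h0
  rw [ENNReal.tendsto_nhds_zero] at hb ⊢
  intro ε hε
  obtain ⟨K, hK⟩ := eventually_atTop.1 (hb ε hε)
  filter_upwards [Ioo_mem_nhdsGT (hr K)] with r hrK
  have hK1 : (7 / 8 : ℝ) ^ K ≤ 1 := pow_le_one₀ (by norm_num) (by norm_num)
  have hr0 := hr 0
  -- To pass from the discrete radii to all r, r is placed between two consecutive ones; the larger
  -- is at most 2r, so one doubling suffices.
  have hscale : ∀ k, geomScale R k / N = (7 / 8) ^ k * (geomScale R 0 / N) := by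
    intro k; unfold geomScale; ring
  have hq : r / (geomScale R 0 / N) < (7 / 8) ^ K := by
    rw [div_lt_iff₀ hr0, ← hscale]; exact hrK.2
  obtain ⟨n, hn1, hn2⟩ := exists_nat_pow_near_of_lt_one (div_pos hrK.1 hr0) (hq.le.trans hK1)
    (by norm_num : (0 : ℝ) < 7 / 8) (by norm_num)
  have hnK : K < n + 1 := (pow_lt_pow_iff_right_of_lt_one₀ (by norm_num) (by norm_num)).1
    (hn1.trans hq)
  rw [lt_div_iff₀ hr0, ← hscale] at hn1
  rw [div_le_iff₀ hr0, ← hscale] at hn2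
  refine le_trans ?_ (hK n (by omega))
  have hsub : geomScale R n / N ≤ 2 ^ 1 * r := by
    have : geomScale R (n + 1) / N = 7 / 8 * (geomScale R n / N) := by
      rw [geomScale_succ]; ring
    have := hrK.1
    linarith
  have hle := h.ball_le (y := x) (r' := geomScale R n / N) hx hrK.1 1
    (by rw [dist_self, zero_add]; exact hsub)
  rw [pow_one] at hle
  refine (setLAverage_le_mul (ball_subset_ball hn2) hle (h.pos x hx r hrK.1).ne'
    (h.lt_top x hx r hrK.1).ne (h.lt_top x hx _ (hr n)).ne _).trans ?_
  gcongr
  exact setLAverage_enorm_sub_le (h.pos x hx _ (hr n)).ne' (h.lt_top x hx _ (hr n)).ne _ _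

end

/-! ### Integral bounds for the potential -/

/-- Minkowski's inequality for series of non-negative functions. -/
theorem lintegral_Lp_tsum_le {X : Type*} [MeasurableSpace X] {ν : Measure X} {t : ℝ} (ht : 1 ≤ t)
    {f : ℕ → X → ℝ≥0∞} (hf : ∀ k, Measurable (f k)) :
    (∫⁻ x, (∑' k, f k x) ^ t ∂ν) ^ (1 / t) ≤ ∑' k, (∫⁻ x, f k x ^ t ∂ν) ^ (1 / t) := by
  have ht0 : 0 < t := by linarith
  have hfin : ∀ n, (∫⁻ x, (∑ k ∈ Finset.range n, f k x) ^ t ∂ν) ^ (1 / t) ≤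
      ∑' k, (∫⁻ x, f k x ^ t ∂ν) ^ (1 / t) := by
    intro n
    refine le_trans ?_ (ENNReal.sum_le_tsum (Finset.range n))
    induction n with
    | zero => simp [ht0]
    | succ n ih =>
      simp only [Finset.sum_range_succ]
      refine le_trans ?_ (add_le_add ih le_rfl)
      exact ENNReal.lintegral_Lp_add_le
        (Finset.measurable_sum _ fun k _ => hf k).aemeasurable (hf n).aemeasurable ht
  have hmono : Monotone fun n x => (∑ k ∈ Finset.range n, f k x) ^ t := by
    intro n n' hn x
    simp only
    gcongr
  have hsup : ∀ x, (∑' k, f k x) ^ t = ⨆ n, (∑ k ∈ Finset.range n, f k x) ^ t := by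
    intro x
    rw [ENNReal.tsum_eq_iSup_nat]
    exact (ENNReal.orderIsoRpow t ht0).map_iSup _
  simp only [hsup]
  rw [lintegral_iSup (fun n => (Finset.measurable_sum _ fun k _ => hf k).pow_const t) hmono]
  rw [show (⨆ n, ∫⁻ x, (∑ k ∈ Finset.range n, f k x) ^ t ∂ν) ^ (1 / t) =
    ⨆ n, (∫⁻ x, (∑ k ∈ Finset.range n, f k x) ^ t ∂ν) ^ (1 / t) from
    (ENNReal.orderIsoRpow (1 / t) (by positivity)).map_iSup _]
  exact iSup_le hfin

/-- The constant in the bound for the potential. -/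
def potentialConst (c K : ℝ≥0∞) (Cs θ s p t : ℝ) : ℝ≥0∞ :=
  (c ^ 5 * K) ^ (1 / t) * ENNReal.ofReal (Cs ^ (-(1 / p - 1 / t)) *
    (6 : ℝ) ^ (-(1 - θ / t - s * (1 / p - 1 / t)))) *
    (1 - ENNReal.ofReal ((7 / 8) ^ (1 - θ / t - s * (1 / p - 1 / t))))⁻¹

/-- Positivity of the exponent makes (7/8)^κ < 1, so the geometric series hidden in the last factor
converges. -/
theorem potentialConst_ne_top {c K : ℝ≥0∞} (hc : c ≠ ⊤) (hK : K ≠ ⊤) {Cs θ s p t : ℝ} (ht : 0 < t)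
    (hκ : 0 < 1 - θ / t - s * (1 / p - 1 / t)) : potentialConst c K Cs θ s p t ≠ ⊤ := by
  refine ENNReal.mul_ne_top (ENNReal.mul_ne_top (ENNReal.rpow_ne_top_of_nonneg (by positivity)
    (ENNReal.mul_ne_top (ENNReal.pow_ne_top hc) hK)) ENNReal.ofReal_ne_top)
    (ENNReal.inv_ne_top.2 (tsub_pos_of_lt ?_).ne')
  rw [ENNReal.ofReal_lt_one]
  exact Real.rpow_lt_one (by norm_num) (by norm_num) hκ

section

variable {X : Type*} [MetricSpace X] [MeasurableSpace X] [BorelSpace X]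
  {m ν : Measure X} {E : Set X} {c : ℝ≥0∞}

theorem setLIntegral_ball_inter_eq {F : Set X} (hF : MeasurableSet F) (w : X → ℝ≥0∞) (r : ℝ)
    (x : X) : ∫⁻ v in ball x r ∩ F, w v ∂m =
      ∫⁻ v, {q : X × X | dist q.2 q.1 < r ∧ q.2 ∈ F}.indicator (fun q => w q.2) (x, v) ∂m := by
  rw [← lintegral_indicator (measurableSet_ball.inter hF)]
  rfl

variable [SecondCountableTopology X]

theorem measurable_measure_ball [SFinite m] (r : ℝ) : Measurable fun x => m (ball x r) := by
  have hs : MeasurableSet {q : X × X | dist q.2 q.1 < r} :=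
    measurableSet_lt (measurable_snd.dist measurable_fst) measurable_const
  exact measurable_measure_prodMk_left hs

theorem measurableSet_dist_lt_and {F : Set X} (hF : MeasurableSet F) (r : ℝ) :
    MeasurableSet {q : X × X | dist q.2 q.1 < r ∧ q.2 ∈ F} :=
  (measurableSet_lt (measurable_snd.dist measurable_fst) measurable_const).inter
    (measurable_snd hF)

theorem measurable_localMean [SFinite m] {F : Set X} (hF : MeasurableSet F) {w : X → ℝ≥0∞}
    (hw : Measurable w) (p D : ℝ) : Measurable (localMean m p w F D) := by
  unfold localMean
  refine ((measurable_measure_ball D).inv.mul ?_).pow_const _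
  simp only [setLIntegral_ball_inter_eq hF]
  exact Measurable.lintegral_prod_right'
    ((hw.comp measurable_snd).indicator (measurableSet_dist_lt_and hF _))

/-- After Tonelli the inner integral runs over x in B(v,9D). There 1/m(B(x,D)) is comparable to
1/m(B(v,9D)), because 18D ≤ 2^5 D, and the bound on ν cancels that mass. -/
theorem IsDoublingAt.lintegral_inv_mul_le [SFinite m] [SFinite ν] (h : IsDoublingAt m E c)
    (hmE : ∀ᵐ x ∂m, x ∈ E) (hνE : ∀ᵐ x ∂ν, x ∈ E) {F : Set X} (hF : MeasurableSet F)
    {w : X → ℝ≥0∞} (hw : Measurable w) {D : ℝ} (hD : 0 < D) {K : ℝ≥0∞}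
    (hν : ∀ y ∈ E, ν (ball y (9 * D)) ≤ K * m (ball y (9 * D))) :
    ∫⁻ x, (m (ball x D))⁻¹ * ∫⁻ v in ball x (9 * D) ∩ F, w v ∂m ∂ν ≤
      c ^ 5 * K * ∫⁻ v in F, w v ∂m := by
  have hmeas := measurableSet_dist_lt_and (X := X) hF (9 * D)
  have hG : Measurable fun q : X × X =>
      {q : X × X | dist q.2 q.1 < 9 * D ∧ q.2 ∈ F}.indicator (fun q => w q.2) q :=
    (hw.comp measurable_snd).indicator hmeas
  have hb : Measurable fun x => (m (ball x D))⁻¹ := (measurable_measure_ball D).inv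
  simp only [setLIntegral_ball_inter_eq hF]
  calc _ = ∫⁻ x, ∫⁻ v, (m (ball x D))⁻¹ * {q : X × X | dist q.2 q.1 < 9 * D ∧ q.2 ∈ F}.indicator
        (fun q => w q.2) (x, v) ∂m ∂ν :=
        lintegral_congr fun x =>
          (lintegral_const_mul _ (hG.comp measurable_prodMk_left)).symm
    _ = ∫⁻ v, ∫⁻ x, (m (ball x D))⁻¹ * {q : X × X | dist q.2 q.1 < 9 * D ∧ q.2 ∈ F}.indicator
        (fun q => w q.2) (x, v) ∂ν ∂m :=
        lintegral_lintegral_swap ((hb.comp measurable_fst).mul hG).aemeasurable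
    _ ≤ ∫⁻ v, F.indicator (fun v => c ^ 5 * K * w v) v ∂m := by
        refine lintegral_mono_ae ?_
        filter_upwards [hmE] with v hv
        by_cases hvF : v ∈ F
        · rw [indicator_of_mem hvF]
          have hpos := (h.pos v hv (9 * D) (by positivity)).ne'
          have hfin := (h.lt_top v hv (9 * D) (by positivity)).ne
          calc _ ≤ ∫⁻ x, (ball v (9 * D)).indicator
                (fun _ => c ^ 5 * (m (ball v (9 * D)))⁻¹ * w v) x ∂ν := by
                refine lintegral_mono_ae ?_
                filter_upwards [hνE] with x hx
                by_cases hxv : dist v x < 9 * D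
                · rw [indicator_of_mem (by exact ⟨hxv, hvF⟩),
                    indicator_of_mem (by rw [mem_ball, dist_comm]; exact hxv)]
                  gcongr
                  exact h.inv_ball_le hx hv hD (by positivity) 5 (by linarith)
                · rw [indicator_of_notMem (fun hq => hxv hq.1), mul_zero]
                  exact zero_le
            _ = c ^ 5 * (m (ball v (9 * D)))⁻¹ * w v * ν (ball v (9 * D)) := by
                rw [lintegral_indicator measurableSet_ball, setLIntegral_const]
            _ ≤ c ^ 5 * (m (ball v (9 * D)))⁻¹ * w v * (K * m (ball v (9 * D))) := by
                gcongr; exact hν v hv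
            _ = c ^ 5 * K * w v * ((m (ball v (9 * D)))⁻¹ * m (ball v (9 * D))) := by ring
            _ = _ := by rw [ENNReal.inv_mul_cancel hpos hfin, mul_one]
        · rw [indicator_of_notMem hvF]
          refine (lintegral_eq_zero_of_ae_eq_zero (Eventually.of_forall fun x => ?_)).le
          rw [indicator_of_notMem (fun hq => hvF hq.2), mul_zero]
          rfl
    _ = _ := by rw [lintegral_indicator hF, lintegral_const_mul _ hw]

/-- Integral of a power of the local means at one scale. -/
theorem IsDoublingAt.lintegral_localMean_rpow_le [SFinite m] [SFinite ν] (h : IsDoublingAt m E c)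
    (hmE : ∀ᵐ x ∂m, x ∈ E) (hνE : ∀ᵐ x ∂ν, x ∈ E) {F : Set X} (hF : MeasurableSet F)
    {w : X → ℝ≥0∞} (hw : Measurable w) {D : ℝ} (hD : 0 < D) {K : ℝ≥0∞}
    (hν : ∀ y ∈ E, ν (ball y (9 * D)) ≤ K * m (ball y (9 * D))) {b : ℝ≥0∞}
    (hb : ∀ᵐ x ∂ν, b ≤ m (ball x D)) {p t : ℝ} (hp : 0 < p) (hpt : p ≤ t) :
    ∫⁻ x, localMean m p w F D x ^ t ∂ν ≤
      (b⁻¹ * ∫⁻ v in F, w v ∂m) ^ (t / p - 1) * (c ^ 5 * K * ∫⁻ v in F, w v ∂m) := by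
  have hα : 0 ≤ t / p - 1 := by rw [sub_nonneg, one_le_div hp]; exact hpt
  refine le_trans ?_ (mul_le_mul_right (h.lintegral_inv_mul_le hmE hνE hF hw hD hν) _)
  have hmeas : Measurable fun x => (m (ball x D))⁻¹ * ∫⁻ v in ball x (9 * D) ∩ F, w v ∂m := by
    refine (measurable_measure_ball D).inv.mul ?_
    simp only [setLIntegral_ball_inter_eq hF]
    exact Measurable.lintegral_prod_right'
      ((hw.comp measurable_snd).indicator (measurableSet_dist_lt_and hF _))
  rw [← lintegral_const_mul _ hmeas]
  refine lintegral_mono_ae ?_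
  filter_upwards [hb] with x hx
  -- The power t splits as p + (t - p): the excess is bounded uniformly through the lower mass bound
  -- `b`, and the p-th power is integrated.
  rw [localMean, ← ENNReal.rpow_mul, show 1 / p * t = (t / p - 1) + 1 by ring,
    ENNReal.rpow_add_of_nonneg _ _ hα zero_le_one, ENNReal.rpow_one]
  gcongr
  exact inter_subset_right

/-- `L^p`–`L^t` bound for the potential, with respect to a measure `ν` of codimension `θ`. -/
theorem IsDoublingAt.lintegral_chainPotential_rpow_le [SFinite m] [SFinite ν]
    (h : IsDoublingAt m E c) (hmE : ∀ᵐ x ∂m, x ∈ E) (hνE : ∀ᵐ x ∂ν, x ∈ E) {F : Set X}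
    (hF : MeasurableSet F) {w : X → ℝ≥0∞} (hw : Measurable w) {R θ s p t Cs : ℝ} {K : ℝ≥0∞}
    (hR : 0 < R) (hp : 0 < p) (hpt : p ≤ t) (ht : 1 ≤ t) (hθ : 0 ≤ θ) (hCs : 0 < Cs)
    (hν : ∀ y ∈ E, ∀ r, 0 < r → r ≤ 3 / 2 * R →
      ν (ball y r) ≤ K * ENNReal.ofReal (r ^ (-θ)) * m (ball y r)) {B : ℝ≥0∞}
    (hlow : ∀ᵐ x ∂ν, ∀ r, 0 < r → r ≤ R → ENNReal.ofReal (Cs * (r / R) ^ s) * B ≤ m (ball x r)) :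
    (∫⁻ x, chainPotential m p w F R x ^ t ∂ν) ^ (1 / t) ≤
      potentialConst c K Cs θ s p t *
        (ENNReal.ofReal (R ^ (1 - θ / t)) * B⁻¹ ^ (1 / p - 1 / t) *
          (∫⁻ v in F, w v ∂m) ^ (1 / p)) := by
  have ht0 : 0 < t := by linarith
  rw [potentialConst]
  set κ := 1 - θ / t - s * (1 / p - 1 / t) with hκdef
  set β := 1 / p - 1 / t with hβdef
  have hβ : 0 ≤ β := sub_nonneg.2 (one_div_le_one_div_of_le hp hpt)
  set W := ∫⁻ v in F, w v ∂m with hW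
  have hterm : ∀ k, (∫⁻ x, (ENNReal.ofReal (geomScale R k) *
      localMean m p w F (geomScale R k) x) ^ t ∂ν) ^ (1 / t) ≤
      ((c ^ 5 * K) ^ (1 / t) * ENNReal.ofReal (Cs ^ (-β) * (6 : ℝ) ^ (-κ)) *
        (ENNReal.ofReal (R ^ (1 - θ / t)) * B⁻¹ ^ β * W ^ (1 / p))) *
        ENNReal.ofReal ((7 / 8) ^ κ) ^ k := by
    intro k
    have hD := geomScale_pos hR k
    set D := geomScale R k with hDdef
    have hDR : D ≤ R / 6 := by
      have : (7 / 8 : ℝ) ^ k ≤ 1 := pow_le_one₀ (by norm_num) (by norm_num)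
      rw [hDdef, geomScale]
      have := mul_le_mul_of_nonneg_right this hR.le
      linarith
    have hbk0 : 0 < Cs * (D / R) ^ s := by positivity
    have hmain := h.lintegral_localMean_rpow_le (K := K * ENNReal.ofReal (D ^ (-θ)))
      (b := ENNReal.ofReal (Cs * (D / R) ^ s) * B) hmE hνE hF hw hD
      (fun y hy => (hν y hy (9 * D) (by positivity) (by linarith)).trans (by
        gcongr K * ENNReal.ofReal ?_ * _
        exact Real.rpow_le_rpow_of_nonpos hD (by linarith) (by linarith)))
      (hlow.mono fun x hx => hx D hD (by linarith)) hp hpt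
    -- The powers of the scale collected: what depends on k is exactly (7/8)^(κk).
    have hreal : D * D ^ (-θ * (1 / t)) * (Cs * (D / R) ^ s) ^ (-β) =
        Cs ^ (-β) * (6 : ℝ) ^ (-κ) * R ^ (1 - θ / t) * ((7 / 8) ^ κ) ^ k := by
      set q : ℝ := (7 / 8) ^ k with hq
      have hq0 : 0 < q := by positivity
      have hDq : D = q * R * 6⁻¹ := by rw [hDdef, geomScale]; ring
      have hDR' : D / R = q * 6⁻¹ := by rw [hDq]; field_simp
      have e1 : D * D ^ (-θ * (1 / t)) = D ^ (1 - θ / t) := by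
        rw [show 1 - θ / t = 1 + -θ * (1 / t) by ring, Real.rpow_add hD, Real.rpow_one]
      rw [e1, Real.mul_rpow hCs.le (by positivity), ← Real.rpow_mul (by positivity), hDR', hDq,
        Real.mul_rpow (by positivity) (by positivity), Real.mul_rpow (by positivity) hR.le,
        Real.mul_rpow (x := q) (by positivity) (by positivity)]
      have e2 : ((7 / 8 : ℝ) ^ κ) ^ k = q ^ κ := by
        rw [hq, ← Real.rpow_natCast, ← Real.rpow_natCast, ← Real.rpow_mul (by norm_num),
          ← Real.rpow_mul (by norm_num), mul_comm]
      have e3 : q ^ κ = q ^ (1 - θ / t) * q ^ (s * -β) := by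
        rw [← Real.rpow_add hq0]; congr 1; rw [hκdef]; ring
      have e4 : (6 : ℝ) ^ (-κ) = 6⁻¹ ^ (1 - θ / t) * 6⁻¹ ^ (s * -β) := by
        rw [← Real.rpow_add (by norm_num), Real.inv_rpow (by norm_num),
          Real.rpow_neg (by norm_num)]
        congr 2; rw [hκdef]; ring
      rw [e2, e3, e4]
      ring
    calc _ = ENNReal.ofReal D * (∫⁻ x, localMean m p w F D x ^ t ∂ν) ^ (1 / t) := by
          simp only [ENNReal.mul_rpow_of_nonneg _ _ ht0.le]
          rw [lintegral_const_mul _ ((measurable_localMean hF hw p D).pow_const t),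
            ENNReal.mul_rpow_of_nonneg _ _ (by positivity), ← ENNReal.rpow_mul,
            mul_one_div_cancel ht0.ne', ENNReal.rpow_one]
      _ ≤ ENNReal.ofReal D * (((ENNReal.ofReal (Cs * (D / R) ^ s) * B)⁻¹ * W) ^ (t / p - 1) *
            (c ^ 5 * (K * ENNReal.ofReal (D ^ (-θ))) * W)) ^ (1 / t) := by gcongr
      _ = (c ^ 5 * K) ^ (1 / t) * (ENNReal.ofReal D * ENNReal.ofReal (D ^ (-θ)) ^ (1 / t) *
            (ENNReal.ofReal (Cs * (D / R) ^ s))⁻¹ ^ β) * B⁻¹ ^ β * (W ^ β * W ^ (1 / t)) := by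
          rw [ENNReal.mul_rpow_of_nonneg _ _ (by positivity), ← ENNReal.rpow_mul,
            show (t / p - 1) * (1 / t) = β by rw [hβdef]; field_simp,
            ENNReal.mul_inv (.inl (ENNReal.ofReal_pos.2 hbk0).ne') (.inl ENNReal.ofReal_ne_top),
            ENNReal.mul_rpow_of_nonneg _ _ hβ, ENNReal.mul_rpow_of_nonneg _ _ hβ,
            ← mul_assoc (c ^ 5) K,
            ENNReal.mul_rpow_of_nonneg (c ^ 5 * K * _) _ (by positivity),
            ENNReal.mul_rpow_of_nonneg (c ^ 5 * K) _ (by positivity)]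
          ring
      _ = (c ^ 5 * K) ^ (1 / t) * ENNReal.ofReal (Cs ^ (-β) * (6 : ℝ) ^ (-κ) *
            R ^ (1 - θ / t) * ((7 / 8) ^ κ) ^ k) * B⁻¹ ^ β * W ^ (1 / p) := by
          congr 2
          · congr 2
            rw [← hreal, ENNReal.ofReal_rpow_of_pos (by positivity), ← Real.rpow_mul hD.le,
              ENNReal.inv_rpow, ENNReal.ofReal_rpow_of_pos hbk0,
              ← ENNReal.ofReal_inv_of_pos (by positivity), ← Real.rpow_neg hbk0.le,
              ← ENNReal.ofReal_mul (by positivity), ← ENNReal.ofReal_mul (by positivity)]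
          · rw [← ENNReal.rpow_add_of_nonneg _ _ hβ (by positivity)]
            congr 1; rw [hβdef]; ring
      _ = _ := by
          rw [ENNReal.ofReal_mul (by positivity), ENNReal.ofReal_mul (p := _ * _) (by positivity),
            ENNReal.ofReal_pow (by positivity)]
          ring
  calc _ ≤ ∑' k, (∫⁻ x, (ENNReal.ofReal (geomScale R k) *
        localMean m p w F (geomScale R k) x) ^ t ∂ν) ^ (1 / t) :=
        lintegral_Lp_tsum_le ht fun k => (measurable_localMean hF hw p _).const_mul _
    _ ≤ _ := ENNReal.tsum_le_tsum hterm
    _ = _ := by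
        rw [ENNReal.tsum_mul_left, ENNReal.tsum_geometric]
        ring

end

/-! ### Poincaré inequality, Lebesgue points and the codimension bound on the closure -/

/-- Monotonicity of L^q norms for the normalised measure; this lets the means of g^q be replaced by
means of g^p. -/
theorem rpow_setLAverage_le {X : Type*} [MeasurableSpace X] {m : Measure X} {B : Set X}
    (h0 : m B ≠ 0) (h1 : m B ≠ ⊤) {g : X → ℝ}
    (hg : AEStronglyMeasurable g m) {p q : ℝ} (hq : 0 < q) (hqp : q ≤ p) :
    (⨍⁻ y in B, ‖g y‖ₑ ^ q ∂m) ^ (1 / q) ≤ (⨍⁻ y in B, ‖g y‖ₑ ^ p ∂m) ^ (1 / p) := by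
  have : IsFiniteMeasure (m.restrict B) := ⟨by simpa using h1.lt_top⟩
  have : NeZero (m.restrict B) := ⟨by simpa [Measure.restrict_eq_zero] using h0⟩
  exact eLpNorm'_le_eLpNorm'_of_exponent_le hq hqp ((m.restrict B univ)⁻¹ • m.restrict B)
    (hg.restrict.smul_measure _)

theorem IsDoublingAt.ballOsc_le_two_mul {X : Type*} [MetricSpace X] [MeasurableSpace X]
    {m : Measure X} {E : Set X} {c : ℝ≥0∞}
    (h : IsDoublingAt m E c) {u : X → ℝ} (hu : Integrable u m) {x : X} (hx : x ∈ E) {r : ℝ}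
    (hr : 0 < r) (a : ℝ) : ballOsc m u x r ≤ 2 * ⨍⁻ y in ball x r, ‖u y - a‖ₑ ∂m := by
  have h0 := (h.pos x hx r hr).ne'
  have h1 := (h.lt_top x hx r hr).ne
  refine (setLAverage_enorm_sub_le h0 h1 a _).trans ?_
  rw [_root_.two_mul, enorm_sub_rev a]
  gcongr
  exact enorm_setAverage_sub_le hu.integrableOn h0 h1 a

section

variable {X : Type*} [MetricSpace X] [MeasurableSpace X] [BorelSpace X]

theorem restrict_ball_apply (μ : Measure X) (Ω : Set X) (x : X) (r : ℝ) :
    μ.restrict Ω (ball x r) = μ (ball x r ∩ Ω) :=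
  Measure.restrict_apply measurableSet_ball

theorem restrict_restrict_ball (μ : Measure X) (Ω : Set X) (x : X) (r : ℝ) :
    (μ.restrict Ω).restrict (ball x r) = μ.restrict (ball x r ∩ Ω) :=
  Measure.restrict_restrict measurableSet_ball

theorem IsDoublingOn.exists_isDoublingAt {μ : Measure X} {Ω : Set X} (h : IsDoublingOn μ Ω) :
    ∃ c : ℝ≥0∞, IsDoublingAt (μ.restrict Ω) (closure Ω) c := by
  obtain ⟨c, -, hc⟩ := h
  refine ⟨ENNReal.ofReal c, ENNReal.ofReal_ne_top, ?_, ?_, ?_⟩ <;> intro x hx r hr <;>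
    simp only [restrict_ball_apply]
  · have := (hc x hx (r / 2) (by positivity)).1
    rwa [mul_div_cancel₀ r (by norm_num)] at this
  · exact (hc x hx r hr).2.2
  · exact (hc x hx r hr).2.1

/-- A `q`-PI gradient gives a Poincaré inequality at the level of `p`-th powers, for balls centred
in the closure, whose constant does not depend on the dilation of the balls. -/
theorem IsPIGradient.exists_poincareAt {μ : Measure X} {Ω : Set X} {c : ℝ≥0∞}
    (h : IsDoublingAt (μ.restrict Ω) (closure Ω) c) {p q : ℝ} (hq : 0 < q) (hqp : q ≤ p)
    {u g : X → ℝ} (hu : Integrable u (μ.restrict Ω)) (hg : IsPIGradient μ Ω q u g)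
    {w : X → ℝ≥0∞} (hw : w =ᵐ[μ.restrict Ω] fun y => ‖g y‖ₑ ^ p) :
    ∃ N : ℕ, 0 < N ∧
      PoincareAt (μ.restrict Ω) (closure Ω) p (4 * c ^ 2 * (c ^ 2) ^ (1 / p)) N u w := by
  obtain ⟨hgm, -, Λ, hΛ, hPI⟩ := hg
  simp only [← restrict_restrict_ball] at hPI
  set m := μ.restrict Ω with hm
  have hp : 0 < p := hq.trans_le hqp
  -- The lower bound on N fits the dilated ball about the nearby point x' ∈ Ω into B(x,D). The upper
  -- bound makes these two balls comparable with a constant free of Λ.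
  have hN1 : 4 * Λ ≤ ⌈4 * Λ⌉₊ := Nat.le_ceil _
  have hN2 : (⌈4 * Λ⌉₊ : ℝ) < 4 * Λ + 1 := Nat.ceil_lt_add_one (by linarith)
  set N := ⌈4 * Λ⌉₊ with hN
  have hN0 : (0 : ℝ) < N := by linarith
  refine ⟨N, by exact_mod_cast hN0, fun x hx D hD => ?_⟩
  set r := D / N with hr
  have hr0 : 0 < r := by positivity
  have hNr : N * r = D := by rw [hr]; field_simp
  have hΛr1 : 4 * (Λ * r) ≤ D := by
    rw [← hNr, ← mul_assoc]; gcongr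
  have hΛr2 : D ≤ 5 * (Λ * r) := by
    rw [← hNr, ← mul_assoc]; gcongr; linarith
  have hrΛ : r ≤ Λ * r := le_mul_of_one_le_left hr0.le hΛ
  obtain ⟨x', hx', hxx'⟩ := Metric.mem_closure_iff.1 hx r hr0
  have hx'E : x' ∈ closure Ω := subset_closure hx'
  set a := ⨍ v in ball x' (2 * r), u v ∂m with ha
  have hdil : 0 < Λ * (2 * r) := by positivity
  have e1 := h.ballOsc_le_two_mul hu hx hr0 a
  have e2 : ⨍⁻ y in ball x r, ‖u y - a‖ₑ ∂m ≤ c ^ 2 * ⨍⁻ y in ball x' (2 * r), ‖u y - a‖ₑ ∂m :=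
    setLAverage_le_mul (ball_subset_ball' (by linarith))
      (h.ball_le hx hr0 2 (by rw [dist_comm]; linarith)) (h.pos x hx r hr0).ne'
      (h.lt_top x hx r hr0).ne (h.lt_top x' hx'E _ (by positivity)).ne _
  have e3 := hPI x' hx' (2 * r) (by positivity)
  have e4 := rpow_setLAverage_le (h.pos x' hx'E _ hdil).ne' (h.lt_top x' hx'E _ hdil).ne hgm hq hqp
  have e5 : (⨍⁻ y in ball x' (Λ * (2 * r)), ‖g y‖ₑ ^ p ∂m) ^ (1 / p) ≤
      (c ^ 2) ^ (1 / p) * ((m (ball x D))⁻¹ * ∫⁻ y in ball x D, w y ∂m) ^ (1 / p) := by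
    rw [setLAverage_eq, ← lintegral_congr_ae (ae_restrict_of_ae hw), ENNReal.div_eq_inv_mul,
      ← ENNReal.mul_rpow_of_nonneg _ _ (by positivity), ← mul_assoc (c ^ 2)]
    gcongr
    · exact h.inv_ball_le hx'E hx hdil hD 2 (by linarith)
    · exact ball_subset_ball' (by rw [dist_comm]; linarith)
  calc ballOsc m u x r ≤ 2 * (c ^ 2 * (ENNReal.ofReal (2 * r) *
        ((c ^ 2) ^ (1 / p) * ((m (ball x D))⁻¹ * ∫⁻ y in ball x D, w y ∂m) ^ (1 / p)))) := by
        refine e1.trans ?_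
        gcongr
        refine e2.trans ?_
        gcongr
        refine e3.trans ?_
        gcongr
        exact e4.trans e5
    _ = _ := by
        rw [ENNReal.ofReal_mul (by norm_num), ENNReal.ofReal_ofNat]
        ring

/-- Lebesgue's differentiation theorem for a measure that is doubling on a set of full measure. -/
theorem IsDoublingAt.ae_tendsto_setLAverage [SecondCountableTopology X] {m : Measure X}
    [IsFiniteMeasure m] {E : Set X} {c : ℝ≥0∞} (h : IsDoublingAt m E c) (hEm : MeasurableSet E)
    (hmE : ∀ᵐ x ∂m, x ∈ E) {u : X → ℝ} (hu : Integrable u m) :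
    ∀ᵐ x ∂m, Tendsto (fun r => ⨍⁻ v in ball x r, ‖u v - u x‖ₑ ∂m) (𝓝[>] 0) (𝓝 0) := by
  -- Doubling is known only at points of E, so the differentiation theorem is applied on the subtype
  -- E and transported back.
  set m' : Measure E := m.comap Subtype.val with hm'
  have hemb := MeasurableEmbedding.subtype_coe hEm
  have hmap : m'.map Subtype.val = m := by
    rw [hm', map_comap_subtype_coe hEm, Measure.restrict_eq_self_of_ae_mem hmE]
  have hball : ∀ (x : E) (r : ℝ), m' (closedBall x r) = m (closedBall x.1 r) := by
    intro x r
    conv_rhs => rw [← hmap, hemb.map_apply]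
    rfl
  have : IsFiniteMeasure m' := ⟨by
    have : m' univ = m'.map Subtype.val univ := by rw [hemb.map_apply]; rfl
    rw [this, hmap]; exact measure_lt_top _ _⟩
  have hclosed : ∀ x ∈ E, ∀ r : ℝ, 0 < r → m (closedBall x r) ≤ c * m (ball x r) :=
    fun x hx r hr => (measure_mono (closedBall_subset_ball (by linarith))).trans
      (h.two_mul x hx r hr)
  have : IsUnifLocDoublingMeasure m' := ⟨(c ^ 2).toNNReal, by
    filter_upwards [self_mem_nhdsWithin] with r hr x
    have hr : 0 < r := hr
    rw [hball, hball, ENNReal.coe_toNNReal (ENNReal.pow_ne_top h.ne_top), pow_two, mul_assoc]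
    refine (hclosed x.1 x.2 (2 * r) (by positivity)).trans ?_
    gcongr
    refine (h.two_mul x.1 x.2 r hr).trans ?_
    gcongr
    exact ball_subset_closedBall⟩
  have hu' : Integrable (fun y : E => u y.1) m' := by
    rw [← hmap] at hu
    exact hemb.integrable_map_iff.1 hu
  have hae := IsUnifLocDoublingMeasure.ae_tendsto_average_norm_sub m' hu'.locallyIntegrable 1
  have key : ∀ᵐ x ∂(m'.map Subtype.val),
      Tendsto (fun r => ⨍⁻ v in ball x r, ‖u v - u x‖ₑ ∂m) (𝓝[>] 0) (𝓝 0) := by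
    rw [hemb.ae_map_iff]
    filter_upwards [hae] with x hx
    have h1 := hx (l := 𝓝[>] (0 : ℝ)) (fun _ => x) id tendsto_id (by
      filter_upwards [self_mem_nhdsWithin] with r hr
      have hr : 0 < r := hr
      simpa using hr.le)
    have h2 := ENNReal.Tendsto.const_mul (a := c) (ENNReal.tendsto_ofReal h1) (.inr h.ne_top)
    rw [ENNReal.ofReal_zero, mul_zero] at h2
    refine tendsto_of_tendsto_of_tendsto_of_le_of_le' tendsto_const_nhds h2
      (Eventually.of_forall fun _ => zero_le) ?_
    filter_upwards [self_mem_nhdsWithin] with r hr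
    have hr : 0 < r := hr
    have hpos := (h.pos x.1 x.2 r hr).ne'
    have hfin := (h.lt_top x.1 x.2 r hr).ne
    refine (setLAverage_le_mul ball_subset_closedBall (hclosed x.1 x.2 r hr) hpos hfin
      (measure_ne_top _ _) _).trans ?_
    gcongr
    simp only [id]
    have hint : Integrable (fun y : E => ‖u y - u x‖) m' := (hu'.sub (integrable_const _)).norm
    rw [ofReal_setAverage hint.integrableOn (Eventually.of_forall fun _ => norm_nonneg _), hball,
      setLAverage_eq]
    simp only [ofReal_norm]
    conv_lhs => rw [← hmap, hemb.restrict_map, hemb.lintegral_map, hmap]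
    exact le_rfl
  rwa [hmap] at key

/-- A codimension bound for balls centred on the boundary extends to balls centred in the
closure, up to any radius comparable to the diameter. -/
theorem HasUpperCodimBound.exists_measure_ball_le {μ H : Measure X} {Ω : Set X} {θ : ℝ}
    (hH : HasUpperCodimBound μ H Ω θ) (hθ : 0 ≤ θ) (hb : Bornology.IsBounded Ω)
    (hdiam : 0 < diam Ω) {c : ℝ≥0∞} (h : IsDoublingAt (μ.restrict Ω) (closure Ω) c) :
    ∃ K : ℝ≥0∞, K ≠ ⊤ ∧ ∀ y ∈ closure Ω, ∀ r : ℝ, 0 < r → r ≤ 3 * diam Ω →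
      H.restrict (frontier Ω) (ball y r) ≤
        K * ENNReal.ofReal (r ^ (-θ)) * μ.restrict Ω (ball y r) := by
  obtain ⟨C, hC, hH⟩ := hH
  set d := diam Ω with hd
  refine ⟨ENNReal.ofReal C * ENNReal.ofReal ((1 / 2) ^ (-θ)) * c ^ 2,
    ENNReal.mul_ne_top (ENNReal.mul_ne_top ENNReal.ofReal_ne_top ENNReal.ofReal_ne_top)
      (ENNReal.pow_ne_top h.ne_top), fun y hy r hr hrd => ?_⟩
  rw [restrict_ball_apply]
  rcases (ball y r ∩ frontier Ω).eq_empty_or_nonempty with he | ⟨x, hxy, hx⟩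
  · rw [he]; simp
  have hxE : x ∈ closure Ω := frontier_subset_closure hx
  rw [mem_ball] at hxy
  -- The hypothesis covers only radii below 2 diam Ω. Radius 3/2 diam Ω already captures the whole
  -- boundary, and r ≤ 3 diam Ω keeps r' ≥ r/2.
  set r' := min (2 * r) (3 / 2 * d) with hr'
  have hr'1 : r' ≤ 2 * r := min_le_left _ _
  have hr'2 : r' ≤ 3 / 2 * d := min_le_right _ _
  have hr'3 : r * (1 / 2) ≤ r' := le_min (by linarith) (by linarith)
  have hr'0 : 0 < r' := by linarith
  have hsub : ball y r ∩ frontier Ω ⊆ ball x r' ∩ frontier Ω := by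
    rintro v ⟨hv, hvf⟩
    refine ⟨?_, hvf⟩
    have h1 : dist v x ≤ d := by
      rw [hd, ← diam_closure]
      exact dist_le_diam_of_mem hb.closure (frontier_subset_closure hvf) hxE
    have h2 := dist_triangle v y x
    rw [mem_ball] at hv ⊢
    rw [dist_comm y x] at h2
    exact lt_min (by linarith) (by linarith)
  have hball : μ.restrict Ω (ball x r') ≤ c ^ 2 * μ.restrict Ω (ball y r) :=
    h.ball_le hy hr 2 (by linarith)
  calc H (ball y r ∩ frontier Ω) ≤ H (ball x r' ∩ frontier Ω) := measure_mono hsub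
    _ ≤ ENNReal.ofReal C * (μ (ball x r' ∩ Ω) / ENNReal.ofReal (r' ^ θ)) :=
        hH x hx r' hr'0 (by linarith)
    _ = ENNReal.ofReal C * (μ.restrict Ω (ball x r') * ENNReal.ofReal (r' ^ (-θ))) := by
        rw [Real.rpow_neg hr'0.le, ENNReal.ofReal_inv_of_pos (by positivity), ← div_eq_mul_inv,
          restrict_ball_apply]
    _ ≤ ENNReal.ofReal C * (c ^ 2 * μ.restrict Ω (ball y r) *
          ENNReal.ofReal (r ^ (-θ) * (1 / 2) ^ (-θ))) := by
        gcongr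
        rw [← Real.mul_rpow hr.le (by norm_num)]
        exact Real.rpow_le_rpow_of_nonpos (by positivity) hr'3 (by linarith)
    _ = _ := by
        rw [ENNReal.ofReal_mul (by positivity)]
        ring

end

/-! ### Trace estimates on a regular set -/

/-- The measure `m` lives on the measurable set `E`, where it is doubling and satisfies a lower
mass bound with exponent `s`, and `E` has approximate geodesics. -/
structure IsRegularOn {X : Type*} [MetricSpace X] [MeasurableSpace X] (m : Measure X) (E : Set X)
    (c : ℝ≥0∞) (s Cs : ℝ) : Prop extends IsDoublingAt m E c where
  measurableSet : MeasurableSet E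
  ae_mem : ∀ᵐ x ∂m, x ∈ E
  geodesic : ∀ x ∈ E, ∀ y ∈ E, ∀ t η : ℝ, 0 < t → t < dist x y → 0 < η →
    ∃ v ∈ E, dist x v = t ∧ dist v y < dist x y - t + η
  const_pos : 0 < Cs
  lower : ∀ r R : ℝ, 0 < r → r ≤ R → ∀ y ∈ E, ∀ x ∈ ball y R ∩ E,
    ENNReal.ofReal (Cs * (r / R) ^ s) * m (ball y R) ≤ m (ball x r)

/-- The constant that relates limits of mean values and the chain potential. -/
def chainConst (c A : ℝ≥0∞) (p : ℝ) : ℝ≥0∞ := (4 * c ^ 2 + c) * A * (c ^ 3) ^ (1 / p)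

theorem chainConst_ne_top {c A : ℝ≥0∞} (hc : c ≠ ⊤) (hA : A ≠ ⊤) {p : ℝ} (hp : 0 < p) :
    chainConst c A p ≠ ⊤ := by
  refine ENNReal.mul_ne_top (ENNReal.mul_ne_top (ENNReal.add_ne_top.2 ⟨?_, hc⟩) hA)
    (ENNReal.rpow_ne_top_of_nonneg (by positivity) (ENNReal.pow_ne_top hc))
  exact ENNReal.mul_ne_top (by norm_num) (ENNReal.pow_ne_top hc)

section

variable {X : Type*} [MetricSpace X] [MeasurableSpace X] [BorelSpace X]
  [SecondCountableTopology X] {m ν : Measure X} {E : Set X} {c A K : ℝ≥0∞} {s Cs p t θ : ℝ}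
  {N : ℕ} {u : X → ℝ} {w : X → ℝ≥0∞}

theorem measurable_chainPotential [SFinite m] {F : Set X} (hF : MeasurableSet F)
    (hw : Measurable w) (p R : ℝ) : Measurable (chainPotential m p w F R) :=
  Measurable.tsum fun _ => (measurable_localMean hF hw p _).const_mul _

/-- The pointwise chain bound, integrated against ν on B(z,R). The radii needed are at most 9R/6 =
3R/2. Leaving ν and θ free allows a second use with ν = m. -/
theorem IsRegularOn.lintegral_enorm_sub_rpow_le [SFinite m] [SFinite ν]
    (h : IsRegularOn m E c s Cs) (hνE : ∀ᵐ x ∂ν, x ∈ E) (hp : 0 < p) (hpt : p ≤ t) (ht : 1 ≤ t)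
    (hθ : 0 ≤ θ) (hu : Integrable u m) (hw : Measurable w) (hN : 0 < N)
    (hPI : PoincareAt m E p A N u w) {z : X} (hz : z ∈ E) {R : ℝ} (hR : 0 < R)
    (hν : ∀ y ∈ E, ∀ r, 0 < r → r ≤ 3 / 2 * R →
      ν (ball y r) ≤ K * ENNReal.ofReal (r ^ (-θ)) * m (ball y r)) {f : X → ℝ}
    (hf : ∀ᵐ x ∂ν, Tendsto (fun r => ⨍⁻ v in ball x r, ‖u v - f x‖ₑ ∂m) (𝓝[>] 0) (𝓝 0)) :
    (∫⁻ x in ball z R, ‖f x - ballAvg m u z (geomScale R 0 / N)‖ₑ ^ t ∂ν) ^ (1 / t) ≤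
      chainConst c A p * potentialConst c K Cs θ s p t *
        (ENNReal.ofReal (R ^ (1 - θ / t)) * (m (ball z R))⁻¹ ^ (1 / p - 1 / t) *
          (∫⁻ v in ball z R, w v ∂m) ^ (1 / p)) := by
  have ht0 : 0 < t := by linarith
  have hball : ∀ᵐ x ∂ν.restrict (ball z R), x ∈ ball z R := ae_restrict_mem measurableSet_ball
  have hmain := h.lintegral_chainPotential_rpow_le (ν := ν.restrict (ball z R)) (F := ball z R)
    (B := m (ball z R)) h.ae_mem (ae_restrict_of_ae hνE) measurableSet_ball hw hR hp hpt ht hθ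
    h.const_pos
    (fun y hy r hr hrR => (Measure.restrict_apply_le _ _).trans (hν y hy r hr hrR)) (by
      filter_upwards [hball, ae_restrict_of_ae hνE] with x hxz hx r hr hrR
      exact h.lower r R hr hrR z hz x ⟨hxz, hx⟩)
  rw [mul_assoc]
  refine le_trans ?_ (mul_le_mul_right hmain _)
  calc _ ≤ (∫⁻ x in ball z R, chainConst c A p ^ t * chainPotential m p w (ball z R) R x ^ t ∂ν) ^
        (1 / t) := by
        gcongr ?_ ^ _
        refine lintegral_mono_ae ?_
        filter_upwards [hball, ae_restrict_of_ae hνE, ae_restrict_of_ae hf] with x hxz hx hfx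
        rw [← ENNReal.mul_rpow_of_nonneg _ _ ht0.le, enorm_sub_rev]
        gcongr
        exact h.enorm_ballAvg_sub_le_chainPotential h.geodesic hu hp hN hPI hx hz hxz hfx
    _ = _ := by
        rw [lintegral_const_mul _ ((measurable_chainPotential measurableSet_ball hw p R).pow_const t),
          ENNReal.mul_rpow_of_nonneg _ _ (by positivity), ← ENNReal.rpow_mul,
          mul_one_div_cancel ht0.ne', ENNReal.rpow_one]

/-- Comparison of the mean values over a ball and over a small concentric ball, in terms of the
gradient inside the ball only. -/
theorem IsRegularOn.enorm_ballAvg_sub_le [IsFiniteMeasure m] (h : IsRegularOn m E c s Cs)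
    (hp : 1 ≤ p) (hu : Integrable u m) (hw : Measurable w) (hN : 0 < N)
    (hPI : PoincareAt m E p A N u w) {z : X} (hz : z ∈ E) {R : ℝ} (hR : 0 < R) :
    ‖ballAvg m u z R - ballAvg m u z (geomScale R 0 / N)‖ₑ ≤
      chainConst c A p * potentialConst c 1 Cs 0 s p p *
        (ENNReal.ofReal R * (m (ball z R))⁻¹ ^ (1 / p) *
          (∫⁻ v in ball z R, w v ∂m) ^ (1 / p)) := by
  have hp0 : 0 < p := by linarith
  have hpos := (h.pos z hz R hR).ne'
  have hfin := (h.lt_top z hz R hR).ne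
  -- With ν = m the codimension bound is trivial (θ = 0, K = 1), and u is its own limit of means.
  -- The result controls u minus the small-ball mean on all of B(z,R), without a factor depending on
  -- N.
  have hmain := h.lintegral_enorm_sub_rpow_le (ν := m) (t := p) (θ := 0) (K := 1) (f := u)
    h.ae_mem hp0 le_rfl hp le_rfl hu hw hN hPI hz hR (fun y _ r _ _ => by simp)
    (h.ae_tendsto_setLAverage h.measurableSet h.ae_mem hu)
  rw [sub_self, ENNReal.rpow_zero, mul_one, zero_div, sub_zero, Real.rpow_one] at hmain
  set a := ballAvg m u z (geomScale R 0 / N) with ha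
  have hpow := rpow_setLAverage_le (m := m) (g := fun x => u x - a) hpos hfin
    (hu.aestronglyMeasurable.sub aestronglyMeasurable_const) one_pos hp
  simp only [ENNReal.rpow_one, div_one] at hpow
  refine ((enorm_setAverage_sub_le hu.integrableOn hpos hfin a).trans hpow).trans ?_
  rw [setLAverage_eq, ENNReal.div_eq_inv_mul, ENNReal.mul_rpow_of_nonneg _ _ (by positivity)]
  calc _ ≤ (m (ball z R))⁻¹ ^ (1 / p) * (chainConst c A p * potentialConst c 1 Cs 0 s p p *
        (ENNReal.ofReal R * (∫⁻ v in ball z R, w v ∂m) ^ (1 / p))) := by gcongr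
    _ = _ := by ring

/-- The triangle inequality through the small-ball mean `a`: its difference from the mean over
B(z,R) is a constant, whose L^t norm is governed by ν(B(z,R))^(1/t) and hence by the codimension
bound. -/
theorem IsRegularOn.eLpNorm_sub_ballAvg_le [IsFiniteMeasure m] [SFinite ν]
    (h : IsRegularOn m E c s Cs) (hνE : ∀ᵐ x ∂ν, x ∈ E) (hp : 1 ≤ p) (hpt : p ≤ t)
    (hθ : 0 ≤ θ) (hu : Integrable u m) (hw : Measurable w) (hN : 0 < N)
    (hPI : PoincareAt m E p A N u w) {z : X} (hz : z ∈ E) {R : ℝ} (hR : 0 < R)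
    (hν : ∀ y ∈ E, ∀ r, 0 < r → r ≤ 3 / 2 * R →
      ν (ball y r) ≤ K * ENNReal.ofReal (r ^ (-θ)) * m (ball y r)) {f : X → ℝ}
    (hfm : AEStronglyMeasurable f ν)
    (hf : ∀ᵐ x ∂ν, Tendsto (fun r => ⨍⁻ v in ball x r, ‖u v - f x‖ₑ ∂m) (𝓝[>] 0) (𝓝 0)) :
    eLpNorm (fun x => f x - ballAvg m u z R) (ENNReal.ofReal t) (ν.restrict (ball z R)) ≤
      chainConst c A p * (potentialConst c K Cs θ s p t +
          potentialConst c 1 Cs 0 s p p * K ^ (1 / t)) *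
        (ENNReal.ofReal (R ^ (1 - θ / t)) * (m (ball z R))⁻¹ ^ (1 / p - 1 / t) *
          (∫⁻ v in ball z R, w v ∂m) ^ (1 / p)) := by
  have ht : 1 ≤ t := hp.trans hpt
  have ht0 : 0 < t := by linarith
  have hp0 : 0 < p := by linarith
  have ht0' : ENNReal.ofReal t ≠ 0 := (ENNReal.ofReal_pos.2 ht0).ne'
  have hpos := (h.pos z hz R hR).ne'
  have hfin := (h.lt_top z hz R hR).ne
  set a := ballAvg m u z (geomScale R 0 / N) with ha
  set W := ∫⁻ v in ball z R, w v ∂m with hW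
  set B := m (ball z R) with hB
  have h1 : eLpNorm (fun x => f x - a) (ENNReal.ofReal t) (ν.restrict (ball z R)) ≤
      chainConst c A p * potentialConst c K Cs θ s p t *
        (ENNReal.ofReal (R ^ (1 - θ / t)) * B⁻¹ ^ (1 / p - 1 / t) * W ^ (1 / p)) := by
    rw [eLpNorm_eq_lintegral_rpow_enorm_toReal ht0' ENNReal.ofReal_ne_top,
      ENNReal.toReal_ofReal ht0.le]
    exact h.lintegral_enorm_sub_rpow_le hνE hp0 hpt ht hθ hu hw hN hPI hz hR hν hf
  have h2 := h.enorm_ballAvg_sub_le hp hu hw hN hPI hz hR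
  have h3 := hν z hz R hR (by linarith)
  have h4 : eLpNorm (fun _ : X => a - ballAvg m u z R) (ENNReal.ofReal t)
      (ν.restrict (ball z R)) ≤ chainConst c A p * (potentialConst c 1 Cs 0 s p p * K ^ (1 / t)) *
        (ENNReal.ofReal (R ^ (1 - θ / t)) * B⁻¹ ^ (1 / p - 1 / t) * W ^ (1 / p)) := by
    rw [eLpNorm_const' _ ht0' ENNReal.ofReal_ne_top, ENNReal.toReal_ofReal ht0.le,
      Measure.restrict_apply_univ, enorm_sub_rev]
    calc _ ≤ chainConst c A p * potentialConst c 1 Cs 0 s p p *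
          (ENNReal.ofReal R * B⁻¹ ^ (1 / p) * W ^ (1 / p)) *
          (K * ENNReal.ofReal (R ^ (-θ)) * B) ^ (1 / t) := by gcongr
      _ = chainConst c A p * (potentialConst c 1 Cs 0 s p p * K ^ (1 / t)) *
          ((ENNReal.ofReal R * ENNReal.ofReal (R ^ (-θ)) ^ (1 / t)) *
            (B⁻¹ ^ (1 / p) * B ^ (1 / t)) * W ^ (1 / p)) := by
          rw [ENNReal.mul_rpow_of_nonneg _ _ (by positivity),
            ENNReal.mul_rpow_of_nonneg _ _ (by positivity)]
          ring
      _ = _ := by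
          congr 3
          · rw [ENNReal.ofReal_rpow_of_pos (by positivity), ← Real.rpow_mul hR.le,
              ← ENNReal.ofReal_mul hR.le, show 1 - θ / t = 1 + -θ * (1 / t) by ring,
              Real.rpow_add hR, Real.rpow_one]
          · rw [sub_eq_add_neg, ENNReal.rpow_add _ _ (ENNReal.inv_ne_zero.2 hfin)
              (ENNReal.inv_ne_top.2 hpos), ENNReal.inv_rpow B (-(1 / t)), ENNReal.rpow_neg, inv_inv]
  calc _ = eLpNorm ((fun x => f x - a) + fun _ : X => a - ballAvg m u z R) (ENNReal.ofReal t)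
        (ν.restrict (ball z R)) := by
        congr 1; ext x; simp
    _ ≤ _ := eLpNorm_add_le (hfm.restrict.sub aestronglyMeasurable_const)
        aestronglyMeasurable_const (ENNReal.one_le_ofReal.2 ht)
    _ ≤ _ := add_le_add h1 h4
    _ = _ := by ring

/-- A set of full measure of points where the mean values over shrinking balls converge. -/
theorem IsRegularOn.ae_exists_tendsto [IsFiniteMeasure m] [SFinite ν]
    (h : IsRegularOn m E c s Cs) (hνE : ∀ᵐ x ∂ν, x ∈ E) (hp : 1 ≤ p) (hθ : 0 ≤ θ) (hθp : θ < p)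
    (hA : A ≠ ⊤) (hK : K ≠ ⊤) (hu : Integrable u m) (hw : Measurable w) (hwfin : ∫⁻ v, w v ∂m ≠ ⊤)
    (hN : 0 < N) (hPI : PoincareAt m E p A N u w) {z : X} (hz : z ∈ E) {R : ℝ} (hR : 0 < R)
    (hER : E ⊆ ball z R)
    (hν : ∀ y ∈ E, ∀ r, 0 < r → r ≤ 3 / 2 * R →
      ν (ball y r) ≤ K * ENNReal.ofReal (r ^ (-θ)) * m (ball y r)) :
    ∀ᵐ x ∂ν, ∃ f : ℝ, Tendsto (fun r => ⨍⁻ v in ball x r, ‖u v - f‖ₑ ∂m) (𝓝[>] 0) (𝓝 0) := by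
  have hp0 : 0 < p := by linarith
  -- At t = p the exponent κ reduces to 1 - θ/p, which is positive because θ < p.
  have hmain := h.lintegral_chainPotential_rpow_le (ν := ν) (F := univ) (θ := θ)
    (B := m (ball z R)) h.ae_mem hνE MeasurableSet.univ hw hR hp0 le_rfl hp hθ h.const_pos hν (by
      filter_upwards [hνE] with x hx r hr hrR
      exact h.lower r R hr hrR z hz x ⟨hER hx, hx⟩)
  have hfin : ∫⁻ x, chainPotential m p w univ R x ^ p ∂ν ≠ ⊤ := by
    have : (∫⁻ x, chainPotential m p w univ R x ^ p ∂ν) ^ (1 / p) ≠ ⊤ := by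
      refine ne_top_of_le_ne_top ?_ hmain
      refine ENNReal.mul_ne_top (potentialConst_ne_top h.ne_top hK hp0 ?_)
        (ENNReal.mul_ne_top (ENNReal.mul_ne_top ENNReal.ofReal_ne_top ?_)
          (ENNReal.rpow_ne_top_of_nonneg (by positivity) ?_))
      · rw [sub_self, mul_zero, sub_zero, sub_pos, div_lt_one hp0]; exact hθp
      · rw [sub_self, ENNReal.rpow_zero]; exact ENNReal.one_ne_top
      · rwa [Measure.restrict_univ]
    intro h0
    rw [h0, ENNReal.top_rpow_of_pos (by positivity)] at this
    exact this rfl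
  filter_upwards [ae_lt_top ((measurable_chainPotential MeasurableSet.univ hw p R).pow_const p) hfin,
    hνE] with x hx hxE
  refine h.exists_tendsto_of_chainPotential_ne_top hu hp0 hA hN hPI hxE hR fun h0 => ?_
  rw [h0, ENNReal.top_rpow_of_pos hp0] at hx
  exact lt_irrefl _ hx

/-- The mean is a parameter integral over the measurable set {dist < r} in X × X, with u replaced by
a measurable representative. -/
theorem stronglyMeasurable_ballAvg [SFinite m] (hu : AEStronglyMeasurable u m) (r : ℝ) :
    StronglyMeasurable fun x => ballAvg m u x r := by
  have hcongr : ∀ x, ballAvg m u x r = (m (ball x r)).toReal⁻¹ *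
      ∫ v, {q : X × X | dist q.2 q.1 < r}.indicator (fun q => hu.mk u q.2) (x, v) ∂m := by
    intro x
    rw [ballAvg, setAverage_eq, smul_eq_mul, setIntegral_congr_ae measurableSet_ball
      (hu.ae_eq_mk.mono fun v hv _ => hv), ← integral_indicator measurableSet_ball]
    rfl
  simp only [hcongr]
  refine (measurable_measure_ball r).ennreal_toReal.inv.stronglyMeasurable.mul ?_
  refine StronglyMeasurable.integral_prod_right'
    (f := {q : X × X | dist q.2 q.1 < r}.indicator fun q : X × X => hu.mk u q.2) ?_
  exact (hu.stronglyMeasurable_mk.comp_measurable measurable_snd).indicator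
    (measurableSet_lt (measurable_snd.dist measurable_fst) measurable_const)

end

/-! ### Assembly of the trace theorem -/

section

variable {X : Type*} [MetricSpace X] [MeasurableSpace X]

/-- Balls of radius R₀ carry all the mass, so the lower mass bound between R and R₀ turns the mass
of the ball into a power of R. -/
theorem IsRegularOn.inv_measure_ball_rpow_le {m : Measure X} {E : Set X} {c : ℝ≥0∞} {s Cs : ℝ}
    (h : IsRegularOn m E c s Cs) {R₀ : ℝ} (hE : ∀ z ∈ E, E ⊆ ball z R₀) {β : ℝ} (hβ : 0 ≤ β)
    {z : X} (hz : z ∈ E) {R : ℝ} (hR : 0 < R) (hR₀ : R ≤ R₀) :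
    (m (ball z R))⁻¹ ^ β ≤
      ENNReal.ofReal (Cs ^ (-β) * R₀ ^ (s * β)) * (m univ)⁻¹ ^ β * ENNReal.ofReal (R ^ (-(s * β))) := by
  have hR₀' : 0 < R₀ := hR.trans_le hR₀
  have hCs := h.const_pos
  have huniv : m (ball z R₀) = m univ :=
    measure_congr (eventuallyEq_univ.2 (h.ae_mem.mono fun x hx => hE z hz hx))
  have hlow := h.lower R R₀ hR hR₀ z hz z ⟨mem_ball_self hR₀', hz⟩
  rw [huniv] at hlow
  have hpos : 0 < Cs * (R / R₀) ^ s := by positivity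
  have hreal : (Cs * (R / R₀) ^ s) ^ (-β) = Cs ^ (-β) * R₀ ^ (s * β) * R ^ (-(s * β)) := by
    rw [Real.mul_rpow hCs.le (by positivity), ← Real.rpow_mul (by positivity),
      Real.div_rpow hR.le hR₀'.le, mul_neg, Real.rpow_neg hR₀'.le, div_inv_eq_mul]
    ring
  calc (m (ball z R))⁻¹ ^ β ≤ (ENNReal.ofReal (Cs * (R / R₀) ^ s) * m univ)⁻¹ ^ β := by gcongr
    _ = ENNReal.ofReal ((Cs * (R / R₀) ^ s) ^ (-β)) * (m univ)⁻¹ ^ β := by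
        rw [ENNReal.mul_inv (.inl (ENNReal.ofReal_pos.2 hpos).ne') (.inl ENNReal.ofReal_ne_top),
          ENNReal.mul_rpow_of_nonneg _ _ hβ, ← ENNReal.ofReal_inv_of_pos hpos,
          ENNReal.ofReal_rpow_of_pos (inv_pos.2 hpos), Real.inv_rpow hpos.le,
          Real.rpow_neg hpos.le]
    _ = _ := by
        rw [hreal, ENNReal.ofReal_mul (by positivity)]
        ring

variable [BorelSpace X]

theorem HasLowerMassExponent.exists_isRegularOn {μ : Measure X} {Ω : Set X} {s : ℝ} {c : ℝ≥0∞}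
    (hs : HasLowerMassExponent μ Ω s) (hc : IsDoublingAt (μ.restrict Ω) (closure Ω) c)
    (hΩ : IsOpen Ω) (hlen : IsLengthSpace Ω) :
    ∃ Cs : ℝ, IsRegularOn (μ.restrict Ω) (closure Ω) c s Cs := by
  obtain ⟨Cs, hCs, hlow⟩ := hs
  refine ⟨Cs, ⟨hc, isClosed_closure.measurableSet, ?_, ?_, hCs, ?_⟩⟩
  · exact (ae_restrict_mem hΩ.measurableSet).mono fun x hx => subset_closure hx
  · intro x hx y hy t η ht hty hη
    obtain ⟨v, hv, h1, h2⟩ := hlen.exists_dist_eq_dist_lt hx hy ht hty hη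
    exact ⟨v, subset_closure hv, h1, h2⟩
  · intro r R hr hrR y hy x hx
    rw [restrict_ball_apply, restrict_ball_apply]
    exact hlow r R hr hrR y hy x hx

theorem trace_eq_of_tendsto {μ : Measure X} {Ω : Set X} {c : ℝ≥0∞}
    (h : IsDoublingAt (μ.restrict Ω) (closure Ω) c) {u : X → ℝ}
    (hu : Integrable u (μ.restrict Ω)) {x : X} (hx : x ∈ closure Ω) {f : ℝ}
    (hf : Tendsto (fun r => ⨍⁻ v in ball x r, ‖u v - f‖ₑ ∂(μ.restrict Ω)) (𝓝[>] 0) (𝓝 0)) :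
    trace μ Ω u x = f := by
  have := h.tendsto_ballAvg_nhdsGT hu hx hf
  simp only [ballAvg, restrict_restrict_ball] at this
  exact this.limUnder_eq

/-- The trace is the almost everywhere limit, along radii 1/(n+1), of mean values that are
measurable in the centre. -/
theorem aestronglyMeasurable_trace [SecondCountableTopology X] {μ ν : Measure X} {Ω : Set X}
    {c : ℝ≥0∞} (h : IsDoublingAt (μ.restrict Ω) (closure Ω) c) [SFinite (μ.restrict Ω)]
    (hν : ∀ᵐ x ∂ν, x ∈ closure Ω) {u : X → ℝ} (hu : Integrable u (μ.restrict Ω))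
    (hf : ∀ᵐ x ∂ν, Tendsto (fun r => ⨍⁻ v in ball x r, ‖u v - trace μ Ω u x‖ₑ ∂(μ.restrict Ω))
      (𝓝[>] 0) (𝓝 0)) : AEStronglyMeasurable (trace μ Ω u) ν := by
  refine aestronglyMeasurable_of_tendsto_ae atTop
    (f := fun (n : ℕ) x => ballAvg (μ.restrict Ω) u x (1 / ((n : ℝ) + 1)))
    (fun n => (stronglyMeasurable_ballAvg hu.aestronglyMeasurable _).aestronglyMeasurable) ?_
  filter_upwards [hν, hf] with x hx hfx
  exact (h.tendsto_ballAvg_nhdsGT hu hx hfx).comp (tendsto_nhdsWithin_iff.2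
    ⟨tendsto_one_div_add_atTop_nhds_zero_nat, Eventually.of_forall fun n => by
      rw [mem_Ioi]; positivity⟩)

end

end TraceEst

end

open TraceEst Metric ENNReal in
theorem mainTheorem8 {X : Type*} [MetricSpace X] [MeasurableSpace X] [BorelSpace X]
    (μ H : Measure X) [SigmaFinite μ] (hμ : TraceEst.IsNontrivial μ)
    (Ω : Set X) (hΩ : TraceEst.IsDomain Ω) (hbdd : Bornology.IsBounded Ω)
    (hlen : TraceEst.IsLengthSpace Ω) (hdbl : TraceEst.IsDoublingOn μ Ω)
    (s θ p p' q : ℝ) (hs : TraceEst.HasLowerMassExponent μ Ω s)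
    (hθ : 0 < θ) (hH : TraceEst.HasUpperCodimBound μ H Ω θ)
    (hp1 : 1 ≤ p) (hθp : θ < p) (hps : p < s)
    (hp' : p < p') (hp'' : p' < p * (s - θ) / (s - p))
    (hq : 0 < q) (hqp : q < p) :
    ∃ C : ℝ, 0 < C ∧ ∀ u g : X → ℝ, TraceEst.MemP μ Ω p q u →
      MemLp g (ENNReal.ofReal p) (μ.restrict Ω) → TraceEst.IsPIGradient μ Ω q u g →
      TraceEst.IsTrace μ H Ω p u (TraceEst.trace μ Ω u) ∧
      ∀ z ∈ frontier Ω, ∀ R : ℝ, 0 < R →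
        eLpNorm (fun x => TraceEst.trace μ Ω u x - ⨍ y in Metric.ball z R ∩ Ω, u y ∂μ)
            (ENNReal.ofReal p') (H.restrict (Metric.ball z R ∩ frontier Ω)) ≤
          ENNReal.ofReal
              (C * R ^ ((1 / p' - 1 / (p * (s - θ) / (s - p))) * (s - θ))) *
            eLpNorm g (ENNReal.ofReal p) (μ.restrict (Metric.ball z R ∩ Ω)) := by
  have hp0 : 0 < p := by linarith
  have hp'0 : 0 < p' := by linarith
  have hsp : 0 < s - p := by linarith
  have hsθ : 0 < s - θ := by linarith
  rcases (frontier Ω).eq_empty_or_nonempty with hfr | ⟨z₀, hz₀⟩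
  · refine ⟨1, one_pos, fun u g _ _ _ => ⟨⟨?_, ?_⟩, ?_⟩⟩ <;> simp [hfr]
  have : SecondCountableTopology X :=
    secondCountableTopology_of_ball_pos μ fun x r hr => (hμ x r hr).1
  obtain ⟨c, hc⟩ := hdbl.exists_isDoublingAt
  obtain ⟨Cs, hreg⟩ := hs.exists_isRegularOn hc hΩ.1 hlen
  have hz₀E : z₀ ∈ closure Ω := frontier_subset_closure hz₀
  have hd : 0 < diam Ω := by
    obtain ⟨y, hy⟩ := hΩ.2.1
    have hne : z₀ ≠ y := by
      rintro rfl
      rw [hΩ.1.frontier_eq] at hz₀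
      exact hz₀.2 hy
    rw [← diam_closure]
    exact (dist_pos.2 hne).trans_le (dist_le_diam_of_mem hbdd.closure hz₀E (subset_closure hy))
  -- Large enough for balls centred in the closure to cover it, small enough that 3/2 * R₀ = 9/4
  -- diam Ω stays in the range of the codimension bound.
  set R₀ := 3 / 2 * diam Ω with hR₀
  have hR₀0 : 0 < R₀ := by positivity
  have hE : ∀ z ∈ closure Ω, closure Ω ⊆ ball z R₀ := by
    intro z hz x hx
    have := dist_le_diam_of_mem hbdd.closure hx hz
    rw [diam_closure] at this
    rw [mem_ball]; linarith
  obtain ⟨K, hK, hν⟩ := hH.exists_measure_ball_le hθ.le hbdd hd hc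
  set m := μ.restrict Ω with hm
  set ν := H.restrict (frontier Ω) with hνdef
  have hνE : ∀ᵐ x ∂ν, x ∈ closure Ω :=
    (ae_restrict_mem isClosed_frontier.measurableSet).mono fun x hx => frontier_subset_closure hx
  have hball : ∀ {ρ : Measure X} {z : X}, z ∈ closure Ω → (∀ᵐ x ∂ρ, x ∈ closure Ω) →
      ρ (ball z R₀) = ρ univ := fun hz hρ =>
    measure_congr (eventuallyEq_univ.2 (hρ.mono fun x hx => hE _ hz hx))
  have hmfin : IsFiniteMeasure m := ⟨by
    rw [← hball hz₀E hreg.ae_mem]; exact hc.lt_top _ hz₀E _ hR₀0⟩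
  have hm0 : m univ ≠ 0 := by
    rw [← hball hz₀E hreg.ae_mem]; exact (hc.pos _ hz₀E _ hR₀0).ne'
  have hνfin : IsFiniteMeasure ν := ⟨by
    rw [← hball hz₀E hνE]
    refine (hν z₀ hz₀E R₀ hR₀0 (by linarith)).trans_lt ?_
    exact ENNReal.mul_lt_top (ENNReal.mul_lt_top hK.lt_top ENNReal.ofReal_lt_top)
      (measure_lt_top _ _)⟩
  have hνR : ∀ R ≤ R₀, ∀ y ∈ closure Ω, ∀ r, 0 < r → r ≤ 3 / 2 * R →
      ν (ball y r) ≤ K * ENNReal.ofReal (r ^ (-θ)) * m (ball y r) :=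
    fun R hR y hy r hr hrR => hν y hy r hr (by linarith)
  set A := 4 * c ^ 2 * (c ^ 2) ^ (1 / p) with hAdef
  have hA : A ≠ ⊤ := ENNReal.mul_ne_top (ENNReal.mul_ne_top (by norm_num)
    (ENNReal.pow_ne_top hc.ne_top))
    (ENNReal.rpow_ne_top_of_nonneg (by positivity) (ENNReal.pow_ne_top hc.ne_top))
  set β := 1 / p - 1 / p' with hβdef
  have hβ : 0 ≤ β := sub_nonneg.2 (one_div_le_one_div_of_le hp0 hp'.le)
  set κ := (1 / p' - 1 / (p * (s - θ) / (s - p))) * (s - θ) with hκdef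
  -- The power of R in the theorem is the exponent of the geometric series, so p' < p* is what makes
  -- the series converge.
  have hκ : κ = 1 - θ / p' - s * β := by
    rw [hκdef, hβdef]; field_simp; ring
  have hκ0 : 0 < κ := mul_pos (sub_pos.2 (one_div_lt_one_div_of_lt hp'0 hp'')) hsθ
  have hκp : ∀ {θ' : ℝ}, θ' < p → 0 < 1 - θ' / p - s * (1 / p - 1 / p) := fun hθ' => by
    rw [sub_self, mul_zero, sub_zero, sub_pos, div_lt_one hp0]; exact hθ'
  have hpc0 : potentialConst c 1 Cs 0 s p p ≠ ⊤ :=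
    potentialConst_ne_top hc.ne_top ENNReal.one_ne_top hp0 (hκp hp0)
  have hconst : ∀ {t : ℝ}, 0 < t → 0 < 1 - θ / t - s * (1 / p - 1 / t) →
      chainConst c A p * (potentialConst c K Cs θ s p t +
        potentialConst c 1 Cs 0 s p p * K ^ (1 / t)) ≠ ⊤ := fun ht hκt =>
    ENNReal.mul_ne_top (chainConst_ne_top hc.ne_top hA hp0) (ENNReal.add_ne_top.2
      ⟨potentialConst_ne_top hc.ne_top hK ht hκt,
        ENNReal.mul_ne_top hpc0 (ENNReal.rpow_ne_top_of_nonneg (by positivity) hK)⟩)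
  set C₁ := chainConst c A p * (potentialConst c K Cs θ s p p' +
    potentialConst c 1 Cs 0 s p p * K ^ (1 / p')) with hC₁
  set C₂ := ENNReal.ofReal (Cs ^ (-β) * R₀ ^ (s * β)) * (m univ)⁻¹ ^ β with hC₂
  have hCtop : C₁ * C₂ ≠ ⊤ := ENNReal.mul_ne_top (hconst hp'0 (by rw [← hβdef, ← hκ]; exact hκ0))
    (ENNReal.mul_ne_top ENNReal.ofReal_ne_top
      (ENNReal.rpow_ne_top_of_nonneg hβ (ENNReal.inv_ne_top.2 hm0)))
  -- The constant is fixed before u, g, and hence before Λ and N; the summand 1 only secures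
  -- positivity.
  refine ⟨(C₁ * C₂).toReal + 1, by positivity, fun u g hu hg hPI => ?_⟩
  have hui : Integrable u m := hu.1.integrable (ENNReal.one_le_ofReal.2 hp1)
  have hp0' : ENNReal.ofReal p ≠ 0 := (ENNReal.ofReal_pos.2 hp0).ne'
  set w : X → ℝ≥0∞ := fun y => ‖hg.1.mk g y‖ₑ ^ p with hwdef
  have hw : Measurable w := hg.1.stronglyMeasurable_mk.measurable.enorm.pow_const p
  have hwg : w =ᵐ[m] fun y => ‖g y‖ₑ ^ p := by
    filter_upwards [hg.1.ae_eq_mk] with y hy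
    rw [hwdef, hy]
  have hW : ∀ z R, (∫⁻ v in ball z R, w v ∂m) ^ (1 / p) =
      eLpNorm g (ENNReal.ofReal p) (μ.restrict (ball z R ∩ Ω)) := by
    intro z R
    rw [eLpNorm_eq_lintegral_rpow_enorm_toReal hp0' ENNReal.ofReal_ne_top,
      ENNReal.toReal_ofReal hp0.le, ← restrict_restrict_ball,
      lintegral_congr_ae (ae_restrict_of_ae hwg)]
  have hWfin : ∫⁻ v, w v ∂m ≠ ⊤ := by
    rw [lintegral_congr_ae hwg]
    have := lintegral_rpow_enorm_lt_top_of_eLpNorm_lt_top hp0' ENNReal.ofReal_ne_top hg.2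
    rw [ENNReal.toReal_ofReal hp0.le] at this
    exact this.ne
  obtain ⟨N, hN, hPN⟩ := hPI.exists_poincareAt hc hq hqp.le hui hwg
  have hT : ∀ᵐ x ∂ν, Tendsto (fun r => ⨍⁻ v in ball x r, ‖u v - trace μ Ω u x‖ₑ ∂m)
      (𝓝[>] 0) (𝓝 0) := by
    filter_upwards [hνE, hreg.ae_exists_tendsto hνE hp1 hθ.le hθp hA hK hui hw hWfin hN hPN hz₀E
      hR₀0 (hE z₀ hz₀E) (hνR R₀ le_rfl)] with x hx ⟨f, hf⟩
    rwa [trace_eq_of_tendsto hc hui hx hf]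
  have hTm := aestronglyMeasurable_trace hc hνE hui hT
  refine ⟨⟨⟨hTm, ?_⟩, ?_⟩, ?_⟩
  · have h1 := hreg.eLpNorm_sub_ballAvg_le hνE hp1 le_rfl hθ.le hui hw hN hPN hz₀E hR₀0
      (hνR R₀ le_rfl) hTm hT
    rw [Measure.restrict_eq_self_of_ae_mem (hνE.mono fun x hx => hE z₀ hz₀E hx)] at h1
    have h2 : eLpNorm (fun x => trace μ Ω u x - ballAvg m u z₀ R₀) (ENNReal.ofReal p) ν < ⊤ := by
      refine h1.trans_lt (ENNReal.mul_lt_top (hconst hp0 (hκp hθp)).lt_top ?_)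
      rw [sub_self, ENNReal.rpow_zero, mul_one]
      refine ENNReal.mul_lt_top ENNReal.ofReal_lt_top
        (ENNReal.rpow_lt_top_of_nonneg (by positivity) ?_)
      exact ne_top_of_le_ne_top hWfin (setLIntegral_le_lintegral _ _)
    have h3 : MemLp (fun x => trace μ Ω u x - ballAvg m u z₀ R₀) (ENNReal.ofReal p) ν :=
      ⟨hTm.sub aestronglyMeasurable_const, h2⟩
    have h4 := h3.add (memLp_const (ballAvg m u z₀ R₀))
    simp only [Pi.add_def, sub_add_cancel] at h4
    exact h4.2
  · simpa only [hm, restrict_restrict_ball] using hT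
  · have hsmall : ∀ z ∈ closure Ω, ∀ R, 0 < R → R ≤ R₀ →
        eLpNorm (fun x => trace μ Ω u x - ballAvg m u z R) (ENNReal.ofReal p')
          (ν.restrict (ball z R)) ≤ ENNReal.ofReal (((C₁ * C₂).toReal + 1) * R ^ κ) *
            (∫⁻ v in ball z R, w v ∂m) ^ (1 / p) := by
      intro z hz R hR hRR₀
      refine (hreg.eLpNorm_sub_ballAvg_le hνE hp1 hp'.le hθ.le hui hw hN hPN hz hR
        (hνR R hRR₀) hTm hT).trans ?_
      rw [← mul_assoc]
      gcongr
      calc _ ≤ C₁ * (ENNReal.ofReal (R ^ (1 - θ / p')) *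
            (C₂ * ENNReal.ofReal (R ^ (-(s * β))))) := by
            gcongr
            exact hreg.inv_measure_ball_rpow_le hE hβ hz hR hRR₀
        _ = C₁ * C₂ * (ENNReal.ofReal (R ^ (1 - θ / p')) *
            ENNReal.ofReal (R ^ (-(s * β)))) := by ring
        _ = ENNReal.ofReal ((C₁ * C₂).toReal) * ENNReal.ofReal (R ^ κ) := by
            rw [ENNReal.ofReal_toReal hCtop, ← ENNReal.ofReal_mul (by positivity),
              ← Real.rpow_add hR, hκ, ← sub_eq_add_neg]
        _ ≤ _ := by
            rw [← ENNReal.ofReal_mul (by positivity)]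
            gcongr
            linarith
    intro z hz R hR
    have hzE := frontier_subset_closure hz
    rw [← hW]
    simp only [← restrict_restrict_ball]
    rcases le_total R R₀ with hRR₀ | hRR₀
    · exact hsmall z hzE R hR hRR₀
    -- Beyond R₀ both sides see the whole of Ω and its boundary. The estimate at R₀ suffices, since
    -- κ > 0 makes R^κ increasing.
    · have hres : ∀ {ρ : Measure X} {r : ℝ}, R₀ ≤ r → (∀ᵐ x ∂ρ, x ∈ closure Ω) →
          ρ.restrict (ball z r) = ρ := fun hr hρ => Measure.restrict_eq_self_of_ae_mem
        (hρ.mono fun x hx => ball_subset_ball hr (hE z hzE hx))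
      have h1 := hsmall z hzE R₀ hR₀0 le_rfl
      rw [hres le_rfl hνE, ballAvg, hres le_rfl hreg.ae_mem] at h1
      rw [hres hRR₀ hνE, ← hm, hres hRR₀ hreg.ae_mem]
      refine h1.trans ?_
      gcongr
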